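/- Let $\Omega\subset\mathbb{R}^3$ be a nonempty bounded open set (for instance a bounded regular domain), $a>0$ and $2<\gamma<4$. Let $H_0^1(\Omega)$ be the closure of $C_c^\infty(\Omega)$ in $H^1(\Omega)$, and write $\|u\|=(\int_\Omega|\nabla u|^2)^{1/2}$ and $\|u\|_\gamma=(\int_\Omega|u|^\gamma)^{1/\gamma}$. For $\lambda>0$ and $u\in H_0^1(\Omega)$ put $$\Phi_\lambda(u)=\frac a2\|u\|^2+\frac\lambda4\|u\|^4-\frac1\gamma\|u\|_\gamma^\gamma ,\qquad \psi_{\lambda,u}(t)=\Phi_\lambda(tu)\quad(t>0),$$ and for $u\neq0$ $$\lambda(u)=C_{a,\gamma}\Big(\frac{\|u\|_\gamma}{\|u\|}\Big)^{\frac{2\gamma}{\gamma-2}},\quad C_{a,\gamma}=a\,\frac{\gamma-2}{4-\gamma}\Big(\frac{4-\gamma}{2a}\Big)^{\frac2{\gamma-2}},\qquad \lambda_0(u)=2\Big(\frac2\gamma\Big)^{\frac2{\gamma-2}}\lambda(u),\qquad t(u)=\Big(\frac{2a}{4-\gamma}\frac{\|u\|^2}{\|u\|_\gamma^\gamma}\Big)^{\frac1{\gamma-2}}.$$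 Let $\lambda^*=\sup_{u\ne0}\lambda(u)$ and $\lambda_0^*=\sup_{u\ne0}\lambda_0(u)$ (suprema over $u\in H_0^1(\Omega)\setminus\{0\}$, a priori in $[0,\infty]$), and let $S_\gamma=\inf_{u\neq0}\|u\|/\|u\|_\gamma$ be the best constant of the embedding $H_0^1(\Omega)\hookrightarrow L^\gamma(\Omega)$. Then: 1. For every $u\in H_0^1(\Omega)\setminus\{0\}$, $(t(u),\lambda(u))$ is the unique pair $(t,\lambda)\in(0,\infty)^2$ with $\psi_{\lambda,u}'(t)=\psi_{\lambda,u}''(t)=0$; and there is exactly one pair $(t,\lambda)\in(0,\infty)^2$ with $\psi_{\lambda,u}(t)=\psi_{\lambda,u}'(t)=0$, and its second entry is $\lambda_0(u)$. 2. $0<S_\gamma<\infty$ and $\lambda^*=C_{a,\gamma}\,S_\gamma^{\frac{2\gamma}{2-\gamma}}$. 3. $\lambda_0^*<\lambda^*<\infty$. 4. There is $u\in H_0^1(\Omega)\setminus\{0\}$ with $\lambda(u)=\lambda^*$ and $\lambda_0(u)=\lambda_0^*$. -/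

import Mathlib

open MeasureTheory
open scoped ContDiff ENNReal

noncomputable section

namespace Kirchhoff

/-- Euclidean space `ℝ³`. -/
abbrev E3 : Type := EuclideanSpace ℝ (Fin 3)

/-- `φ ∈ C_c^∞(Ω)`: a smooth function whose support is a compact subset of `Ω`. -/
structure IsTestFunction (Ω : Set E3) (φ : E3 → ℝ) : Prop where
  smooth : ContDiff ℝ ∞ φ
  compact : HasCompactSupport φ
  subset : tsupport φ ⊆ Ω

/-- The Hilbert space `L²(Ω) × L²(Ω; ℝ³)` with norm `(‖u‖² + ‖g‖²)^{1/2}`. On pairs `(u, ∇u)` this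
is the full `H¹` norm. -/
abbrev L2Pair (Ω : Set E3) : Type :=
  WithLp 2 (Lp ℝ 2 (volume.restrict Ω) × Lp E3 2 (volume.restrict Ω))

/-- `g` is the distributional gradient of `u` on `Ω`. -/
def HasWeakGradient (Ω : Set E3) (u : E3 → ℝ) (g : E3 → E3) : Prop :=
  ∀ φ : E3 → ℝ, IsTestFunction Ω φ → ∀ v : E3,
    ∫ x in Ω, u x * fderiv ℝ φ x v = - ∫ x in Ω, φ x * inner ℝ v (g x)

/-- The space of test functions `C_c^∞(Ω)`, each `φ` being represented by the pair `(φ, ∇φ)`. -/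
def testPairs (Ω : Set E3) : Submodule ℝ (L2Pair Ω) where
  carrier := {p | ∃ φ : E3 → ℝ, IsTestFunction Ω φ ∧
    p.fst =ᵐ[volume.restrict Ω] φ ∧ p.snd =ᵐ[volume.restrict Ω] gradient φ}
  zero_mem' := by
    refine ⟨0, ⟨contDiff_const, HasCompactSupport.zero, by simp⟩, ?_, ?_⟩
    · exact Lp.coeFn_zero _ _ _
    · have h : gradient (0 : E3 → ℝ) = 0 := by
        funext x; simp [gradient]
      rw [h]; exact Lp.coeFn_zero _ _ _
  add_mem' := by
    rintro p q ⟨φ, hφ, hp1, hp2⟩ ⟨ψ, hψ, hq1, hq2⟩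
    refine ⟨φ + ψ, ⟨hφ.smooth.add hψ.smooth, hφ.compact.add hψ.compact, ?_⟩, ?_, ?_⟩
    · exact (tsupport_add φ ψ).trans (Set.union_subset hφ.subset hψ.subset)
    · exact (Lp.coeFn_add _ _).trans (hp1.add hq1)
    · have h : gradient (φ + ψ) = gradient φ + gradient ψ := by
        funext x
        have h1 : DifferentiableAt ℝ φ x := (hφ.smooth.differentiable (by simp)) x
        have h2 : DifferentiableAt ℝ ψ x := (hψ.smooth.differentiable (by simp)) x
        simp [gradient, fderiv_add h1 h2]
      rw [h]; exact (Lp.coeFn_add _ _).trans (hp2.add hq2)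
  smul_mem' := by
    rintro c p ⟨φ, hφ, hp1, hp2⟩
    refine ⟨c • φ, ⟨contDiff_const.smul hφ.smooth, hφ.compact.smul_left (f := fun _ => c), ?_⟩,
      ?_, ?_⟩
    · exact (tsupport_smul_subset_right (fun _ => c) φ).trans hφ.subset
    · exact (Lp.coeFn_smul _ _).trans (hp1.const_smul c)
    · have h : gradient (c • φ) = c • gradient φ := by
        funext x
        have h1 : DifferentiableAt ℝ φ x := (hφ.smooth.differentiable (by simp)) x
        simp [gradient, fderiv_const_smul h1 c]
      rw [h]; exact (Lp.coeFn_smul _ _).trans (hp2.const_smul c)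

/-- The Sobolev space `H_0^1(Ω)`: the closure of `C_c^∞(Ω)` for the `H¹` norm. An element is a pair
`(u, ∇u)`; the second entry is the weak gradient of the first one, see
`hasWeakGradient_of_mem`. -/
def H01 (Ω : Set E3) : Submodule ℝ (L2Pair Ω) := (testPairs Ω).topologicalClosure

/-- The function `u` underlying an element of `H_0^1(Ω)`. -/
def val {Ω : Set E3} (u : H01 Ω) : E3 → ℝ := (u : L2Pair Ω).fst

/-- The weak gradient of an element of `H_0^1(Ω)`. -/
def grad {Ω : Set E3} (u : H01 Ω) : E3 → E3 := (u : L2Pair Ω).snd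

/-- The second entry is the weak gradient of the first. -/
theorem hasWeakGradient_of_mem {Ω : Set E3} (u : H01 Ω) :
    HasWeakGradient Ω (val u) (grad u) := by
  intro φ hφ v
  have hφc : Continuous φ := hφ.smooth.continuous
  have hdc : Continuous (fun x => fderiv ℝ φ x v) :=
    (hφ.smooth.continuous_fderiv (by simp)).clm_apply continuous_const
  have hds : HasCompactSupport (fun x => fderiv ℝ φ x v) := by
    have := hφ.compact.fderiv (𝕜 := ℝ)
    exact this.comp_left (g := fun L : E3 →L[ℝ] ℝ => L v) (by simp)
  have m1 : MemLp (fun x => fderiv ℝ φ x v) 2 (volume.restrict Ω) :=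
    (hdc.memLp_of_hasCompactSupport hds).restrict Ω
  have m2 : MemLp (fun x => φ x • v) 2 (volume.restrict Ω) :=
    ((hφc.smul continuous_const).memLp_of_hasCompactSupport hφ.compact.smul_right).restrict Ω
  have key : ∀ p : L2Pair Ω,
      inner ℝ m1.toLp p.fst + inner ℝ m2.toLp p.snd =
      (∫ x in Ω, p.fst x * fderiv ℝ φ x v) + ∫ x in Ω, φ x * inner ℝ v (p.snd x) := by
    intro p
    rw [L2.inner_def, L2.inner_def]
    congr 1
    · refine integral_congr_ae ?_
      filter_upwards [m1.coeFn_toLp] with x hx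
      rw [hx]; simp
    · refine integral_congr_ae ?_
      filter_upwards [m2.coeFn_toLp] with x hx
      rw [hx, inner_smul_left]; simp
  have hcl : IsClosed {p : L2Pair Ω | inner ℝ m1.toLp p.fst + inner ℝ m2.toLp p.snd = (0 : ℝ)} := by
    refine isClosed_eq ?_ continuous_const
    have c1 : Continuous (fun p : L2Pair Ω => p.fst) := by fun_prop
    have c2 : Continuous (fun p : L2Pair Ω => p.snd) := by fun_prop
    exact (continuous_const.inner c1).add (continuous_const.inner c2)
  have hsub : closure (testPairs Ω : Set (L2Pair Ω)) ⊆
      {p : L2Pair Ω | inner ℝ m1.toLp p.fst + inner ℝ m2.toLp p.snd = (0 : ℝ)} := by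
    refine closure_minimal ?_ hcl
    rintro p ⟨ψ, hψ, h1, h2⟩
    have hψd : Differentiable ℝ ψ := hψ.smooth.differentiable (by simp)
    have hφd : Differentiable ℝ φ := hφ.smooth.differentiable (by simp)
    have hec : Continuous (fun x => fderiv ℝ ψ x v) :=
      (hψ.smooth.continuous_fderiv (by simp)).clm_apply continuous_const
    change _ = _
    rw [key]
    have e1 : ∫ x in Ω, p.fst x * fderiv ℝ φ x v = ∫ x, ψ x * fderiv ℝ φ x v := by
      have h : ∫ x in Ω, p.fst x * fderiv ℝ φ x v = ∫ x in Ω, ψ x * fderiv ℝ φ x v := by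
        refine integral_congr_ae ?_
        filter_upwards [h1] with x hx
        rw [hx]
      rw [h]
      refine setIntegral_eq_integral_of_forall_compl_eq_zero fun x hx => ?_
      rw [image_eq_zero_of_notMem_tsupport (fun h => hx (hψ.subset h)), zero_mul]
    have e2 : ∫ x in Ω, φ x * inner ℝ v (p.snd x) = ∫ x, fderiv ℝ ψ x v * φ x := by
      have h : ∫ x in Ω, φ x * inner ℝ v (p.snd x) = ∫ x in Ω, fderiv ℝ ψ x v * φ x := by
        refine integral_congr_ae ?_
        filter_upwards [h2] with x hx
        rw [hx, gradient, real_inner_comm, InnerProductSpace.toDual_symm_apply, mul_comm]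
      rw [h]
      refine setIntegral_eq_integral_of_forall_compl_eq_zero fun x hx => ?_
      rw [image_eq_zero_of_notMem_tsupport (fun h => hx (hφ.subset h)), mul_zero]
    have ibp : ∫ x, ψ x * fderiv ℝ φ x v = - ∫ x, fderiv ℝ ψ x v * φ x := by
      refine integral_mul_fderiv_eq_neg_fderiv_mul_of_integrable ?_ ?_ ?_
        (fun x _ => hψd x) (fun x _ => hφd x)
      · exact (hec.mul hφc).integrable_of_hasCompactSupport hφ.compact.mul_left
      · exact (hψ.smooth.continuous.mul hdc).integrable_of_hasCompactSupport hψ.compact.mul_right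
      · exact (hψ.smooth.continuous.mul hφc).integrable_of_hasCompactSupport hψ.compact.mul_right
    rw [e1, e2, ibp]; ring
  have h := hsub u.2
  have h' := key (u : L2Pair Ω)
  change inner ℝ m1.toLp _ + inner ℝ m2.toLp _ = (0 : ℝ) at h
  rw [h] at h'
  change ∫ x in Ω, (u : L2Pair Ω).fst x * _ = - ∫ x in Ω, φ x * inner ℝ v ((u : L2Pair Ω).snd x)
  linarith

/-- An element of `H_0^1(Ω)` is determined by its function: it is zero as soon as the function
vanishes almost everywhere. -/
theorem eq_zero_of_val {Ω : Set E3} (hΩ : IsOpen Ω) (u : H01 Ω)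
    (hu : val u =ᵐ[volume.restrict Ω] 0) : u = 0 := by
  have hfst : (u : L2Pair Ω).fst = 0 := by
    apply Lp.ext
    exact hu.trans (Lp.coeFn_zero _ _ _).symm
  have hmem : MemLp (grad u) 2 (volume.restrict Ω) := Lp.memLp _
  have hz : ∀ᵐ x ∂volume, x ∈ Ω → grad u x = 0 := by
    refine hΩ.ae_eq_zero_of_integral_contDiff_smul_eq_zero ?_ ?_
    · rw [locallyIntegrableOn_iff hΩ.isLocallyClosed]
      intro k hk hkc
      have : IsFiniteMeasure (volume.restrict k : Measure E3) :=
        ⟨by simpa using hkc.measure_lt_top⟩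
      have hm : MemLp (grad u) 2 (volume.restrict k) :=
        hmem.mono_measure (Measure.restrict_mono hk le_rfl)
      exact hm.integrable (by norm_num)
    · intro φ hφs hφc hφΩ
      have hφ : IsTestFunction Ω φ := ⟨hφs, hφc, hφΩ⟩
      have m : MemLp φ 2 (volume.restrict Ω) :=
        (hφs.continuous.memLp_of_hasCompactSupport hφc).restrict Ω
      have hint : Integrable (fun x => φ x • grad u x) (volume.restrict Ω) :=
        memLp_one_iff_integrable.1 (hmem.smul (r := 1) m)
      have e : ∫ x, φ x • grad u x = ∫ x in Ω, φ x • grad u x := by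
        refine (setIntegral_eq_integral_of_forall_compl_eq_zero fun x hx => ?_).symm
        rw [image_eq_zero_of_notMem_tsupport (fun h => hx (hφΩ h)), zero_smul]
      rw [e]
      refine ext_inner_left ℝ fun v => ?_
      rw [← integral_inner hint v, inner_zero_right]
      have h := hasWeakGradient_of_mem u φ hφ v
      have h0 : ∫ x in Ω, val u x * fderiv ℝ φ x v = 0 := by
        rw [integral_eq_zero_of_ae]
        filter_upwards [hu] with x hx
        simp [hx]
      rw [h0] at h
      simp only [inner_smul_right]
      linarith
  have hsnd : (u : L2Pair Ω).snd = 0 := by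
    apply Lp.ext
    refine Filter.EventuallyEq.trans ?_ (Lp.coeFn_zero _ _ _).symm
    exact (ae_restrict_iff' hΩ.measurableSet).2 hz
  apply Subtype.ext
  exact (WithLp.ofLp_injective 2) (Prod.ext hfst hsnd)

/-- The norm `‖u‖ = (∫_Ω |∇u|²)^{1/2}` of `H_0^1(Ω)`. -/
def gradNorm {Ω : Set E3} (u : H01 Ω) : ℝ≥0∞ := eLpNorm (grad u) 2 (volume.restrict Ω)

/-- The norm `‖u‖_γ = (∫_Ω |u|^γ)^{1/γ}`, a priori possibly infinite. -/
def gammaNorm {Ω : Set E3} (γ : ℝ) (u : H01 Ω) : ℝ≥0∞ :=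
  eLpNorm (val u) (ENNReal.ofReal γ) (volume.restrict Ω)

/-- The energy functional
`Φ_l(u) = (a/2) ∫ |∇u|² + (l/4) (∫ |∇u|²)² - (1/γ) ∫ |u|^γ`. -/
def energy {Ω : Set E3} (a γ l : ℝ) (u : H01 Ω) : ℝ :=
  a / 2 * (∫ x in Ω, ‖grad u x‖ ^ 2) + l / 4 * (∫ x in Ω, ‖grad u x‖ ^ 2) ^ 2
    - 1 / γ * ∫ x in Ω, |val u x| ^ γ

/-- The fiber map `ψ_{l,u}(t) = Φ_l(t u)`. -/
def fiber {Ω : Set E3} (a γ l : ℝ) (u : H01 Ω) (t : ℝ) : ℝ := energy a γ l (t • u)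

/-- The constant `C_{a,γ}`. -/
def constC (a γ : ℝ) : ℝ :=
  a * ((γ - 2) / (4 - γ)) * ((4 - γ) / (2 * a)) ^ (2 / (γ - 2))

/-- The constant `C_{0,a,γ}`. -/
def constC0 (γ : ℝ) : ℝ := 2 * (2 / γ) ^ (2 / (γ - 2))

/-- `λ(u) = C_{a,γ} (‖u‖_γ / ‖u‖)^{2γ/(γ-2)}`. -/
def lam {Ω : Set E3} (a γ : ℝ) (u : H01 Ω) : ℝ≥0∞ :=
  ENNReal.ofReal (constC a γ) * (gammaNorm γ u / gradNorm u) ^ (2 * γ / (γ - 2))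

/-- `λ₀(u) = C_{0,a,γ} λ(u)`. -/
def lam0 {Ω : Set E3} (a γ : ℝ) (u : H01 Ω) : ℝ≥0∞ :=
  ENNReal.ofReal (constC0 γ) * lam a γ u

/-- `t(u) = ((2a/(4-γ)) ‖u‖² / ‖u‖_γ^γ)^{1/(γ-2)}`. -/
def tOf {Ω : Set E3} (a γ : ℝ) (u : H01 Ω) : ℝ :=
  (2 * a / (4 - γ) * ((∫ x in Ω, ‖grad u x‖ ^ 2) / ∫ x in Ω, |val u x| ^ γ)) ^ (1 / (γ - 2))

/-- The extremal parameter `λ* = sup {λ(u) : u ∈ H_0^1(Ω), u ≠ 0}`. -/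
def lamStar (Ω : Set E3) (a γ : ℝ) : ℝ≥0∞ := ⨆ u : {u : H01 Ω // u ≠ 0}, lam a γ u.1

/-- The parameter `λ₀* = sup {λ₀(u) : u ∈ H_0^1(Ω), u ≠ 0}`. -/
def lam0Star (Ω : Set E3) (a γ : ℝ) : ℝ≥0∞ := ⨆ u : {u : H01 Ω // u ≠ 0}, lam0 a γ u.1

/-- The best constant `S_γ = inf {‖u‖ / ‖u‖_γ : u ∈ H_0^1(Ω), u ≠ 0}` of the embedding of
`H_0^1(Ω)` in `L^γ(Ω)`, that is the largest `S` with `S ‖u‖_γ ≤ ‖u‖` for all `u`. -/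
def bestConst (Ω : Set E3) (γ : ℝ) : ℝ≥0∞ :=
  ⨅ u : {u : H01 Ω // u ≠ 0}, gradNorm u.1 / gammaNorm γ u.1

end Kirchhoff

end

/-!
Averaging over small balls gives a Friedrichs inequality on test functions: the `L¹` norm of `φ` is
at most `ε ‖∇φ‖` plus finitely many ball averages of `φ`. Interpolation with the Sobolev embedding
in `L⁶` turns it into the same inequality for the `L^γ` norm, `γ < 6`, which is the compactness of
`H_0^1(Ω) → L^γ(Ω)`. A maximizing sequence of `‖u‖_γ / ‖u‖` normalized by `‖u‖ = 1` has, after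
extraction, a convergent image in `L^γ`; averages of two late terms then still have almost maximal
image, so uniform convexity of `‖·‖` makes the sequence Cauchy. Its limit attains `λ*`, `λ₀*` and
`S_γ` simultaneously, since all three are monotone functions of this quotient.

Both systems for the fiber map are linear in the unknowns `t^(γ-2)` and `l ‖u‖² t²`. The strict
inequality `λ₀* < λ*` reduces at the extremal to `2 (2/γ)^(2/(γ-2)) < 1`, which is Bernoulli's
inequality `2^((γ-2)/2) < γ/2`.
-/

noncomputable section

namespace Kirchhoff

open Filter Metric Topology
open scoped NNReal

section FriedrichsInequality

variable {E F : Type*} [NormedAddCommGroup E] [NormedAddCommGroup F] {u : E → F}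

theorem enorm_add_sub_le_lintegral_enorm_fderiv [NormedSpace ℝ E] [NormedSpace ℝ F]
    [CompleteSpace F] (hu : ContDiff ℝ 1 u) (x z : E) :
    ‖u (x + z) - u x‖ₑ ≤ ∫⁻ t in Set.Ioc (0 : ℝ) 1, ‖fderiv ℝ u (x + t • z)‖ₑ * ‖z‖ₑ := by
  have hline (t : ℝ) : HasDerivAt (fun t : ℝ => u (x + t • z)) (fderiv ℝ u (x + t • z) z) t :=
    (hu.differentiable one_ne_zero _).hasFDerivAt.comp_hasDerivAt t <| by
      simpa using ((hasDerivAt_id t).smul_const z).const_add x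
  have hcont : Continuous fun t : ℝ => fderiv ℝ u (x + t • z) z := by
    have := hu.continuous_fderiv one_ne_zero
    fun_prop
  have hftc : u (x + z) - u x = ∫ t in Set.Ioc (0 : ℝ) 1, fderiv ℝ u (x + t • z) z := by
    rw [← intervalIntegral.integral_of_le zero_le_one,
      intervalIntegral.integral_eq_sub_of_hasDerivAt (fun t _ => hline t)
        (hcont.intervalIntegrable _ _), one_smul, zero_smul, add_zero]
  rw [hftc]
  exact (enorm_integral_le_lintegral_enorm _).trans
    (lintegral_mono fun t => ContinuousLinearMap.le_opENorm _ _)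

variable [MeasurableSpace E] [BorelSpace E]

theorem integrable_translate_of_hasCompactSupport
    (hu : Continuous u) (hc : HasCompactSupport u) (ν : Measure E) [IsFiniteMeasure ν] (x : E) :
    Integrable (fun z => u (x + z)) ν :=
  (hu.integrable_of_hasCompactSupport hc (μ := ν.map (x + ·))).comp_measurable
    (measurable_const_add x)

variable {μ : Measure E} [μ.IsAddHaarMeasure] [NormedSpace ℝ F]

theorem integral_translate_cond_ball (u : E → F) (x : E) (r : ℝ) :
    ∫ z, u (x + z) ∂(ProbabilityTheory.cond μ (ball 0 r))
      = (μ (ball 0 r))⁻¹.toReal • ∫ y in ball x r, u y ∂μ := by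
  have hball : (x + ·) ⁻¹' ball x r = ball 0 r := by simp
  rw [ProbabilityTheory.cond, integral_smul_measure, ← hball,
    (measurePreserving_add_left μ x).setIntegral_preimage_emb (measurableEmbedding_addLeft x)]

variable [NormedSpace ℝ E] [CompleteSpace F] [FiniteDimensional ℝ E]

theorem lintegral_enorm_translate_sub_le (hu : ContDiff ℝ 1 u) (z : E) :
    ∫⁻ x, ‖u (x + z) - u x‖ₑ ∂μ ≤ ‖z‖ₑ * ∫⁻ x, ‖fderiv ℝ u x‖ₑ ∂μ := by
  have hmeas : Measurable fun p : E × ℝ => ‖fderiv ℝ u (p.1 + p.2 • z)‖ₑ * ‖z‖ₑ := by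
    have := hu.continuous_fderiv one_ne_zero
    exact Measurable.mul_const (Continuous.measurable (by fun_prop)) _
  calc ∫⁻ x, ‖u (x + z) - u x‖ₑ ∂μ
      ≤ ∫⁻ x, ∫⁻ t in Set.Ioc (0 : ℝ) 1, ‖fderiv ℝ u (x + t • z)‖ₑ * ‖z‖ₑ ∂volume ∂μ :=
        lintegral_mono fun x => enorm_add_sub_le_lintegral_enorm_fderiv hu x z
    _ = ∫⁻ t in Set.Ioc (0 : ℝ) 1, ∫⁻ x, ‖fderiv ℝ u (x + t • z)‖ₑ * ‖z‖ₑ ∂μ :=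
        lintegral_lintegral_swap hmeas.aemeasurable
    _ = ∫⁻ _ in Set.Ioc (0 : ℝ) 1, ‖z‖ₑ * ∫⁻ x, ‖fderiv ℝ u x‖ₑ ∂μ := by
        refine lintegral_congr fun t => ?_
        rw [lintegral_mul_const' _ _ enorm_ne_top, mul_comm,
          lintegral_add_right_eq_self (fun x => ‖fderiv ℝ u x‖ₑ) (t • z)]
    _ = ‖z‖ₑ * ∫⁻ x, ‖fderiv ℝ u x‖ₑ ∂μ := by simp

variable {ν : Measure E} [IsProbabilityMeasure ν]

theorem lintegral_enorm_integral_translate_sub_le (hu : ContDiff ℝ 1 u)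
    (hc : HasCompactSupport u) {r : ℝ≥0∞} (hν : ∀ᵐ z ∂ν, ‖z‖ₑ ≤ r) :
    ∫⁻ x, ‖(∫ z, u (x + z) ∂ν) - u x‖ₑ ∂μ ≤ r * ∫⁻ x, ‖fderiv ℝ u x‖ₑ ∂μ := by
  have hcont := hu.continuous
  have hint := integrable_translate_of_hasCompactSupport hcont hc ν
  have hmeas : Measurable fun p : E × E => ‖u (p.1 + p.2) - u p.1‖ₑ :=
    Continuous.measurable (by fun_prop)
  calc ∫⁻ x, ‖(∫ z, u (x + z) ∂ν) - u x‖ₑ ∂μ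
      ≤ ∫⁻ x, ∫⁻ z, ‖u (x + z) - u x‖ₑ ∂ν ∂μ := by
        refine lintegral_mono fun x => ?_
        have : (∫ z, u (x + z) ∂ν) - u x = ∫ z, (u (x + z) - u x) ∂ν := by
          simp [integral_sub (hint x) (integrable_const _)]
        rw [this]
        exact enorm_integral_le_lintegral_enorm _
    _ = ∫⁻ z, ∫⁻ x, ‖u (x + z) - u x‖ₑ ∂μ ∂ν := lintegral_lintegral_swap hmeas.aemeasurable
    _ ≤ ∫⁻ _, r * ∫⁻ x, ‖fderiv ℝ u x‖ₑ ∂μ ∂ν := by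
        refine lintegral_mono_ae (hν.mono fun z hz => ?_)
        exact (lintegral_enorm_translate_sub_le hu z).trans (by gcongr)
    _ = r * ∫⁻ x, ‖fderiv ℝ u x‖ₑ ∂μ := by simp

theorem enorm_integral_translate_sub_integral_translate_le (hu : ContDiff ℝ 1 u)
    (hc : HasCompactSupport u) {C : ℝ≥0∞} (hν : ν ≤ C • μ) (x y : E) :
    ‖(∫ z, u (x + z) ∂ν) - ∫ z, u (y + z) ∂ν‖ₑ
      ≤ C * (‖x - y‖ₑ * ∫⁻ z, ‖fderiv ℝ u z‖ₑ ∂μ) := by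
  have hint := integrable_translate_of_hasCompactSupport hu.continuous hc ν
  calc ‖(∫ z, u (x + z) ∂ν) - ∫ z, u (y + z) ∂ν‖ₑ
      ≤ ∫⁻ z, ‖u (x + z) - u (y + z)‖ₑ ∂ν := by
        rw [← integral_sub (hint x) (hint y)]
        exact enorm_integral_le_lintegral_enorm _
    _ ≤ C * ∫⁻ z, ‖u (x + z) - u (y + z)‖ₑ ∂μ := by
        simpa using lintegral_mono' hν le_rfl
    _ = C * ∫⁻ z, ‖u (z + (x - y)) - u z‖ₑ ∂μ := by
        rw [← lintegral_add_left_eq_self (fun z => ‖u (z + (x - y)) - u z‖ₑ) y]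
        simp only [show ∀ z, y + z + (x - y) = x + z from fun z => by abel]
    _ ≤ C * (‖x - y‖ₑ * ∫⁻ z, ‖fderiv ℝ u z‖ₑ ∂μ) := by
        gcongr
        exact lintegral_enorm_translate_sub_le hu _

theorem exists_finset_enorm_integral_translate_le {K : Set E} (hK : TotallyBounded K) {C : ℝ≥0∞}
    (hν : ν ≤ C • μ) {δ : ℝ≥0} (hδ : 0 < δ) :
    ∃ t : Finset E, ∀ u : E → F, ContDiff ℝ 1 u → HasCompactSupport u → ∀ x ∈ K,
      ‖∫ z, u (x + z) ∂ν‖ₑ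
        ≤ C * (δ * ∫⁻ z, ‖fderiv ℝ u z‖ₑ ∂μ) + ∑ y ∈ t, ‖∫ z, u (y + z) ∂ν‖ₑ := by
  obtain ⟨t, ht, hKt⟩ := EMetric.totallyBounded_iff.1 hK δ (by simpa)
  refine ⟨ht.toFinset, fun u hu hc x hx => ?_⟩
  obtain ⟨y, hy, hxy⟩ : ∃ y ∈ t, ‖x - y‖ₑ < δ := by
    simpa [nndist_eq_nnnorm_sub] using hKt hx
  calc ‖∫ z, u (x + z) ∂ν‖ₑ
      ≤ ‖(∫ z, u (x + z) ∂ν) - ∫ z, u (y + z) ∂ν‖ₑ + ‖∫ z, u (y + z) ∂ν‖ₑ := by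
        simpa using enorm_add_le ((∫ z, u (x + z) ∂ν) - ∫ z, u (y + z) ∂ν) (∫ z, u (y + z) ∂ν)
    _ ≤ C * (δ * ∫⁻ z, ‖fderiv ℝ u z‖ₑ ∂μ) + ∑ y ∈ ht.toFinset, ‖∫ z, u (y + z) ∂ν‖ₑ := by
        gcongr
        · exact (enorm_integral_translate_sub_integral_translate_le hu hc hν x y).trans (by gcongr)
        · exact Finset.single_le_sum (f := fun y => ‖∫ z, u (y + z) ∂ν‖ₑ)
            (fun _ _ => zero_le) (ht.mem_toFinset.2 hy)

theorem lintegral_enorm_le_of_forall_mem_thickening {Ω : Set E} {r : ℝ≥0}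
    (hν : ∀ᵐ z ∂ν, z ∈ ball (0 : E) r) (hu : ContDiff ℝ 1 u) (hc : HasCompactSupport u)
    (hsupp : Function.support u ⊆ Ω) {M : ℝ≥0∞}
    (hM : ∀ x ∈ thickening r Ω, ‖∫ z, u (x + z) ∂ν‖ₑ ≤ M) :
    ∫⁻ x, ‖u x‖ₑ ∂μ ≤ r * ∫⁻ x, ‖fderiv ℝ u x‖ₑ ∂μ + M * μ (thickening r Ω) := by
  have hK : MeasurableSet (thickening (r : ℝ) Ω) := isOpen_thickening.measurableSet
  have haverage (x : E) :
      ‖∫ z, u (x + z) ∂ν‖ₑ ≤ (thickening (r : ℝ) Ω).indicator (fun _ => M) x := by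
    by_cases hx : x ∈ thickening (r : ℝ) Ω
    · simpa only [Set.indicator_of_mem hx] using hM x hx
    · have hvanish : ∀ᵐ z ∂ν, u (x + z) = 0 := hν.mono fun z hz => by
        by_contra h
        exact hx (mem_thickening_iff.2 ⟨x + z, hsupp h, by simpa using hz⟩)
      simp [integral_eq_zero_of_ae hvanish]
  calc ∫⁻ x, ‖u x‖ₑ ∂μ
      ≤ ∫⁻ x, (‖(∫ z, u (x + z) ∂ν) - u x‖ₑ
          + (thickening (r : ℝ) Ω).indicator (fun _ => M) x) ∂μ := by
        refine lintegral_mono fun x => le_trans ?_ (add_le_add_right (haverage x) _)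
        rw [enorm_sub_rev]
        simpa using enorm_add_le (u x - ∫ z, u (x + z) ∂ν) (∫ z, u (x + z) ∂ν)
    _ = ∫⁻ x, ‖(∫ z, u (x + z) ∂ν) - u x‖ₑ ∂μ + M * μ (thickening r Ω) := by
        rw [lintegral_add_right _ (measurable_const.indicator hK), lintegral_indicator_const hK]
    _ ≤ r * ∫⁻ x, ‖fderiv ℝ u x‖ₑ ∂μ + M * μ (thickening r Ω) := by
        gcongr
        refine lintegral_enorm_integral_translate_sub_le hu hc (hν.mono fun z hz => ?_)
        exact mod_cast (mem_ball_zero_iff.1 hz).le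

theorem exists_finset_lintegral_enorm_le {Ω : Set E} (hΩ : Bornology.IsBounded Ω) {ε : ℝ≥0}
    (hε : 0 < ε) :
    ∃ (t : Finset E) (r : ℝ) (C : ℝ≥0), ∀ u : E → F, ContDiff ℝ 1 u → Function.support u ⊆ Ω →
      ∫⁻ x, ‖u x‖ₑ ∂μ ≤ ε * ∫⁻ x, ‖fderiv ℝ u x‖ₑ ∂μ
        + C * ∑ x ∈ t, ‖∫ y in ball x r, u y ∂μ‖ₑ := by
  set r : ℝ≥0 := ε / 2
  have hr : 0 < r := half_pos hε
  set b : ℝ≥0∞ := (μ (ball 0 r))⁻¹ with hb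
  have hball : μ (ball 0 r) ≠ 0 := (measure_ball_pos μ 0 hr).ne'
  have hbtop : b ≠ ⊤ := ENNReal.inv_ne_top.2 hball
  set ν := ProbabilityTheory.cond μ (ball 0 r)
  have : IsProbabilityMeasure ν :=
    ProbabilityTheory.cond_isProbabilityMeasure_of_finite hball measure_ball_lt_top.ne
  have hν : ν ≤ b • μ := by
    unfold ν ProbabilityTheory.cond
    gcongr
    exact Measure.restrict_le_self
  have hK : Bornology.IsBounded (thickening (r : ℝ) Ω) := hΩ.thickening
  lift b * μ (thickening r Ω) to ℝ≥0 using ENNReal.mul_ne_top hbtop hK.measure_lt_top.ne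
    with C hC
  set δ : ℝ≥0 := r / (C + 1)
  have hCδ : C * δ ≤ r := by
    rw [mul_div_left_comm]
    exact mul_le_of_le_one_right' (div_le_one_of_le₀ le_self_add zero_le)
  obtain ⟨t, ht⟩ := exists_finset_enorm_integral_translate_le (F := F)
    (hK.isCompact_closure.totallyBounded.subset subset_closure) hν (δ := δ) (by positivity)
  refine ⟨t, r, C, fun u hu hsupp => ?_⟩
  have hc : HasCompactSupport u := .of_support_subset_isCompact hΩ.isCompact_closure
    (hsupp.trans subset_closure)
  set D := ∫⁻ x, ‖fderiv ℝ u x‖ₑ ∂μ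
  set S := ∑ x ∈ t, ‖∫ y in ball x r, u y ∂μ‖ₑ
  have hsum : ∑ y ∈ t, ‖∫ z, u (y + z) ∂ν‖ₑ = b * S := by
    simp_rw [ν, integral_translate_cond_ball, enorm_smul, ← hb, S, Finset.mul_sum,
      Real.enorm_of_nonneg ENNReal.toReal_nonneg, ENNReal.ofReal_toReal hbtop]
  calc ∫⁻ x, ‖u x‖ₑ ∂μ ≤ r * D + (b * (δ * D) + b * S) * μ (thickening r Ω) :=
        lintegral_enorm_le_of_forall_mem_thickening
          (ProbabilityTheory.ae_cond_mem measurableSet_ball) hu hc hsupp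
          fun x hx => hsum ▸ ht u hu hc x hx
    _ = r * D + (b * μ (thickening r Ω)) * (δ * D + S) := by ring
    _ = ↑(r + C * δ) * D + C * S := by
        rw [← hC]; push_cast; ring
    _ ≤ ε * D + C * S := by
        gcongr
        exact (add_le_add_right hCδ r).trans_eq (add_halves ε)

end FriedrichsInequality

section CompactOperators

variable {X Y F : Type*} [NormedAddCommGroup X] [NormedSpace ℝ X] [NormedAddCommGroup Y]
  [NormedSpace ℝ Y]

theorem isCompactOperator_of_forall_exists_finset_dual [CompleteSpace Y] {L : X →L[ℝ] Y}
    (hL : ∀ ε > 0, ∃ δ > 0, ∃ t : Finset (StrongDual ℝ X), ∀ u, ‖u‖ ≤ 1 →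
      (∀ ℓ ∈ t, ‖ℓ u‖ ≤ δ) → ‖L u‖ ≤ ε) :
    IsCompactOperator L := by
  rw [← ContinuousLinearMap.coe_coe,
    isCompactOperator_iff_isCompact_closure_image_closedBall _ one_pos]
  refine TotallyBounded.isCompact_of_isClosed (TotallyBounded.closure ?_) isClosed_closure
  refine Metric.totallyBounded_iff.2 fun ε hε => ?_
  obtain ⟨δ, hδ, t, ht⟩ := hL (ε / 4) (by positivity)
  let P : X →L[ℝ] (t → ℝ) := ContinuousLinearMap.pi fun ℓ => ℓ.1
  have hP : TotallyBounded (P '' closedBall 0 1) :=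
    (P.lipschitz.isBounded_image isBounded_closedBall).isCompact_closure.totallyBounded.subset
      subset_closure
  obtain ⟨s, hsball, hsfin, hcover⟩ :=
    Set.exists_subset_image_finite_and.1 (hP.exists_subset (Metric.dist_mem_uniformity hδ))
  refine ⟨L '' s, hsfin.image _, ?_⟩
  rintro _ ⟨u, hu, rfl⟩
  obtain ⟨v, hv, huv⟩ : ∃ v ∈ s, dist (P u) (P v) < δ := by
    simpa using hcover (Set.mem_image_of_mem P hu)
  set w : X := (2⁻¹ : ℝ) • (u - v) with hw
  have hw1 : ‖w‖ ≤ 1 := by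
    have := norm_sub_le u v
    have := mem_closedBall_zero_iff.1 hu
    have := mem_closedBall_zero_iff.1 (hsball hv)
    rw [hw, norm_smul, Real.norm_of_nonneg (by norm_num)]
    linarith
  have hwt : ∀ ℓ ∈ t, ‖ℓ w‖ ≤ δ := fun ℓ hℓ => by
    have : ‖ℓ u - ℓ v‖ ≤ dist (P u) (P v) := dist_le_pi_dist (P u) (P v) ⟨ℓ, hℓ⟩
    rw [hw, map_smul, map_sub, norm_smul, Real.norm_of_nonneg (by norm_num)]
    linarith
  have hdist : dist (L u) (L v) = 2 * ‖L w‖ := by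
    rw [hw, map_smul, map_sub, norm_smul, dist_eq_norm, Real.norm_of_nonneg (by norm_num)]
    ring
  exact Set.mem_biUnion (Set.mem_image_of_mem L hv)
    (mem_ball.2 (hdist.trans_lt (by linarith [ht w hw1 hwt])))

theorem cauchySeq_of_forall_lt_norm_add [NormedAddCommGroup F] [NormedSpace ℝ F]
    [UniformConvexSpace F] {x : ℕ → F} (hx : ∀ n, ‖x n‖ ≤ 1)
    (h : ∀ r < 2, ∃ N, ∀ m ≥ N, ∀ n ≥ N, r < ‖x m + x n‖) : CauchySeq x := by
  refine Metric.cauchySeq_iff.2 fun ε hε => ?_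
  obtain ⟨δ, hδ, hconv⟩ := exists_forall_closed_ball_dist_add_le_two_sub F hε
  obtain ⟨N, hN⟩ := h (2 - δ) (by linarith)
  refine ⟨N, fun m hm n hn => ?_⟩
  by_contra! hmn
  exact (hN m hm n hn).not_ge (hconv (hx m) (hx n) (by rwa [← dist_eq_norm]))

theorem exists_norm_eq_of_tendsto_of_isCompactOperator [CompleteSpace X] [NormedAddCommGroup F]
    [NormedSpace ℝ F] [UniformConvexSpace F] {K : X →L[ℝ] Y} (hK : IsCompactOperator K)
    {T : X →L[ℝ] F} {C : ℝ≥0} (hT : AntilipschitzWith C T) {M : ℝ} (hM : 0 < M)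
    (hle : ∀ v, ‖K v‖ ≤ M * ‖T v‖) {u : ℕ → X} (hu : ∀ n, ‖T (u n)‖ ≤ 1)
    (hlim : Tendsto (fun n => ‖K (u n)‖) atTop (𝓝 M)) :
    ∃ w, ‖T w‖ ≤ 1 ∧ ‖K w‖ = M := by
  have hbound (n : ℕ) : ‖u n‖ ≤ C :=
    (T.bound_of_antilipschitz hT (u n)).trans (mul_le_of_le_one_right C.2 (hu n))
  have hcompact : IsCompact (closure (K '' closedBall 0 C)) := by
    rw [← ContinuousLinearMap.coe_coe] at hK ⊢
    exact hK.isCompact_closure_image_closedBall C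
  obtain ⟨y, -, σ, hσ, hy⟩ := hcompact.tendsto_subseq fun n =>
    subset_closure (Set.mem_image_of_mem K (mem_closedBall_zero_iff.2 (hbound n)))
  have hyM : ‖y‖ = M := tendsto_nhds_unique hy.norm (hlim.comp hσ.tendsto_atTop)
  have hcauchy : CauchySeq fun n => T (u (σ n)) := by
    refine cauchySeq_of_forall_lt_norm_add (fun n => hu _) fun r hr => ?_
    have hsum : Tendsto (fun p : ℕ × ℕ => ‖K (u (σ p.1)) + K (u (σ p.2))‖) atTop
        (𝓝 (2 * M)) := by
      have := ((hy.comp tendsto_fst).add (hy.comp tendsto_snd)).norm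
      rwa [← two_smul ℝ y, norm_smul, Real.norm_two, hyM, prod_atTop_atTop_eq] at this
    obtain ⟨N, hN⟩ := eventually_atTop_prod_self'.1
      (hsum.eventually_const_lt (mul_lt_mul_of_pos_right hr hM))
    refine ⟨N, fun m hm n hn => ?_⟩
    have := hle (u (σ m) + u (σ n))
    rw [map_add, map_add] at this
    nlinarith [hN m hm n hn]
  have hcauchyX : CauchySeq fun n => u (σ n) :=
    (hT.isUniformInducing T.uniformContinuous).cauchy_map_iff.1 (by rwa [Filter.map_map])
  obtain ⟨w, hw⟩ := cauchySeq_tendsto_of_complete hcauchyX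
  refine ⟨w, le_of_tendsto ((T.continuous.tendsto w).comp hw).norm
    (Eventually.of_forall fun n => hu _), ?_⟩
  rw [← hyM, tendsto_nhds_unique ((K.continuous.tendsto w).comp hw) hy]

theorem exists_maximizer_of_isCompactOperator [Nontrivial X] [CompleteSpace X]
    [NormedAddCommGroup F] [NormedSpace ℝ F] [UniformConvexSpace F] {K : X →L[ℝ] Y}
    (hK : IsCompactOperator K) {T : X →L[ℝ] F} {C : ℝ≥0} (hT : AntilipschitzWith C T) :
    ∃ u ≠ 0, ∀ v, ‖K v‖ * ‖T u‖ ≤ ‖K u‖ * ‖T v‖ := by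
  have hTpos {v : X} (hv : v ≠ 0) : 0 < ‖T v‖ :=
    norm_pos_iff.2 ((map_ne_zero_iff T hT.injective).2 hv)
  obtain hK0 | ⟨v₀, hv₀⟩ : (∀ v, K v = 0) ∨ ∃ v, K v ≠ 0 := by
    simpa only [not_forall] using em (∀ v, K v = 0)
  · obtain ⟨u, hu⟩ := exists_ne (0 : X)
    exact ⟨u, hu, fun v => by simp [hK0]⟩
  set S : Set ℝ := (fun v => ‖K v‖) '' {v | ‖T v‖ ≤ 1}
  have hS : BddAbove S := ⟨‖K‖ * C, by
    rintro _ ⟨v, hv, rfl⟩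
    exact K.le_opNorm_of_le
      ((T.bound_of_antilipschitz hT v).trans (mul_le_of_le_one_right C.2 hv))⟩
  have hle (v : X) : ‖K v‖ ≤ sSup S * ‖T v‖ := by
    obtain rfl | hv := eq_or_ne v 0
    · simp
    rw [← div_le_iff₀ (hTpos hv)]
    refine le_csSup hS ⟨‖T v‖⁻¹ • v, ?_, ?_⟩
    · simp [norm_smul, (hTpos hv).ne']
    · simp [norm_smul, div_eq_inv_mul]
  have hM : 0 < sSup S := by
    have := (norm_pos_iff.2 hv₀).trans_le (hle v₀)
    exact pos_of_mul_pos_left this (norm_nonneg _)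
  obtain ⟨x, -, hx, hxS⟩ := exists_seq_tendsto_sSup (⟨_, 0, by simp, rfl⟩ : S.Nonempty) hS
  choose u hu hux using hxS
  obtain ⟨w, hTw, hKw⟩ := exists_norm_eq_of_tendsto_of_isCompactOperator hK hT hM hle hu
    (by simpa only [hux] using hx)
  refine ⟨w, ?_, fun v => ?_⟩
  · rintro rfl
    simp [hM.ne] at hKw
  · rw [hKw]
    exact (mul_le_of_le_one_right (norm_nonneg _) hTw).trans (hle v)

end CompactOperators

section LpSeminorm

variable {α F : Type*} {m : MeasurableSpace α} {μ : Measure α} [NormedAddCommGroup F]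

theorem eLpNorm_le_eLpNorm_rpow_mul_eLpNorm_rpow {f : α → F} (hf : AEStronglyMeasurable f μ)
    {p q r θ : ℝ} (hp : 0 < p) (hq : 0 < q) (hr : 0 < r) (hθ₀ : 0 ≤ θ) (hθ₁ : θ ≤ 1)
    (hpqr : 1 / q = θ / p + (1 - θ) / r) :
    eLpNorm f (ENNReal.ofReal q) μ ≤
      eLpNorm f (ENNReal.ofReal p) μ ^ θ * eLpNorm f (ENNReal.ofReal r) μ ^ (1 - θ) := by
  have heLpNorm {s : ℝ} (hs : 0 < s) :
      eLpNorm f (ENNReal.ofReal s) μ = (∫⁻ x, ‖f x‖ₑ ^ s ∂μ) ^ (1 / s) := by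
    rw [eLpNorm_eq_lintegral_rpow_enorm_toReal (ENNReal.ofReal_pos.2 hs).ne'
      ENNReal.ofReal_ne_top, ENNReal.toReal_ofReal hs.le]
  have : 0 ≤ 1 - θ := sub_nonneg.2 hθ₁
  set b := θ * q / p with hb
  set c := (1 - θ) * q / r with hc
  have hbc : b + c = 1 := by
    rw [hb, hc, mul_div_right_comm, mul_div_right_comm, ← add_mul, ← hpqr,
      one_div_mul_cancel hq.ne']
  have hsplit (x : α) : ‖f x‖ₑ ^ q = (‖f x‖ₑ ^ p) ^ b * (‖f x‖ₑ ^ r) ^ c := by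
    rw [← ENNReal.rpow_mul, ← ENNReal.rpow_mul,
      ← ENNReal.rpow_add_of_nonneg _ _ (by positivity) (by positivity), hb, hc]
    congr 1
    field_simp
    ring
  have hb' : b * (1 / q) = 1 / p * θ := by rw [hb]; field_simp
  have hc' : c * (1 / q) = 1 / r * (1 - θ) := by rw [hc]; field_simp
  rw [heLpNorm hp, heLpNorm hq, heLpNorm hr, ← ENNReal.rpow_mul, ← ENNReal.rpow_mul, ← hb', ← hc',
    ENNReal.rpow_mul, ENNReal.rpow_mul, ← ENNReal.mul_rpow_of_nonneg _ _ (by positivity)]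
  refine ENNReal.rpow_le_rpow ?_ (by positivity)
  simp_rw [hsplit]
  exact ENNReal.lintegral_mul_norm_pow_le (hf.enorm.pow_const p) (hf.enorm.pow_const r)
    (by positivity) (by positivity) hbc

theorem lowerSemicontinuous_eLpNorm {p : ℝ≥0∞} [Fact (1 ≤ p)] (q : ℝ≥0∞) :
    LowerSemicontinuous fun f : Lp F p μ => eLpNorm f q μ := by
  refine lowerSemicontinuous_iff_isClosed_preimage.2 fun C => IsSeqClosed.isClosed ?_
  intro f g hf hfg
  obtain ⟨σ, -, hσ⟩ := (tendstoInMeasure_of_tendsto_Lp hfg).exists_seq_tendsto_ae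
  exact Lp.eLpNorm_le_of_ae_tendsto (Eventually.of_forall fun n => hf (σ n))
    (fun n => Lp.aestronglyMeasurable _) hσ

end LpSeminorm

section SobolevSpace

variable {Ω : Set E3}

theorem IsTestFunction.support_subset {φ : E3 → ℝ} (hφ : IsTestFunction Ω φ) :
    Function.support φ ⊆ Ω :=
  (subset_tsupport φ).trans hφ.subset

theorem IsTestFunction.contDiff_one {φ : E3 → ℝ} (hφ : IsTestFunction Ω φ) : ContDiff ℝ 1 φ :=
  hφ.smooth.of_le (by simp)

instance : CompleteSpace (H01 Ω) :=
  (Submodule.isClosed_topologicalClosure _).completeSpace_coe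

theorem H01.induction_on_testFunction {P : H01 Ω → Prop} (hP : IsClosed {u | P u})
    (h : ∀ φ, IsTestFunction Ω φ → ∀ u : H01 Ω, val u =ᵐ[volume.restrict Ω] φ →
      grad u =ᵐ[volume.restrict Ω] gradient φ → P u) (u : H01 Ω) : P u := by
  set D : Set (H01 Ω) := {v | (v : L2Pair Ω) ∈ testPairs Ω}
  have himage : (testPairs Ω : Set (L2Pair Ω)) ⊆ Subtype.val '' D := fun p hp =>
    ⟨⟨p, subset_closure hp⟩, hp, rfl⟩
  have hdense : u ∈ closure D := closure_subtype.2 (closure_mono himage u.2)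
  refine closure_minimal (fun v hv => ?_) hP hdense
  obtain ⟨φ, hφ, hval, hgrad⟩ := hv
  exact h φ hφ v hval hgrad

variable (Ω) in
/-- The inclusion of `H_0^1(Ω)` in `L²(Ω)`. -/
def valCLM : H01 Ω →L[ℝ] Lp ℝ 2 (volume.restrict Ω) :=
  (WithLp.fstL 2 ℝ _ _).comp (H01 Ω).subtypeL

variable (Ω) in
/-- The gradient as a bounded operator from `H_0^1(Ω)` to `L²(Ω; ℝ³)`. -/
def gradCLM : H01 Ω →L[ℝ] Lp E3 2 (volume.restrict Ω) :=
  (WithLp.sndL 2 ℝ _ _).comp (H01 Ω).subtypeL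

theorem enorm_gradCLM (u : H01 Ω) : ‖gradCLM Ω u‖ₑ = gradNorm u :=
  Lp.enorm_def _

theorem continuous_gradNorm : Continuous fun u : H01 Ω => gradNorm u := by
  simpa only [enorm_gradCLM] using (gradCLM Ω).continuous.enorm

theorem gradNorm_ne_top (u : H01 Ω) : gradNorm u ≠ ⊤ :=
  Lp.eLpNorm_ne_top _

theorem norm_le_norm_valCLM_add_norm_gradCLM (u : H01 Ω) :
    ‖u‖ ≤ ‖valCLM Ω u‖ + ‖gradCLM Ω u‖ := by
  change ‖(u : L2Pair Ω)‖ ≤ ‖(u : L2Pair Ω).fst‖ + ‖(u : L2Pair Ω).snd‖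
  rw [WithLp.prod_norm_eq_of_L2]
  refine Real.sqrt_le_iff.2 ⟨by positivity, ?_⟩
  nlinarith [norm_nonneg (u : L2Pair Ω).fst, norm_nonneg (u : L2Pair Ω).snd]

theorem norm_gradCLM_le (u : H01 Ω) : ‖gradCLM Ω u‖ ≤ ‖u‖ :=
  WithLp.norm_snd_le _ (u : L2Pair Ω)

theorem aestronglyMeasurable_val (u : H01 Ω) :
    AEStronglyMeasurable (val u) (volume.restrict Ω) :=
  Lp.aestronglyMeasurable _

theorem gammaNorm_of_ae_eq_testFunction {φ : E3 → ℝ} (hφ : IsTestFunction Ω φ) {u : H01 Ω}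
    (hu : val u =ᵐ[volume.restrict Ω] φ) (γ : ℝ) :
    gammaNorm γ u = eLpNorm φ (ENNReal.ofReal γ) volume := by
  rw [gammaNorm, eLpNorm_congr_ae hu, eLpNorm_restrict_eq_of_support_subset hφ.support_subset]

theorem eLpNorm_grad_of_ae_eq_gradient {φ : E3 → ℝ} (hφ : IsTestFunction Ω φ) {u : H01 Ω}
    (hu : grad u =ᵐ[volume.restrict Ω] gradient φ) (q : ℝ≥0∞) :
    eLpNorm (grad u) q (volume.restrict Ω) = eLpNorm (fderiv ℝ φ) q volume := by
  have henorm (x : E3) : ‖gradient φ x‖ₑ = ‖fderiv ℝ φ x‖ₑ :=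
    (InnerProductSpace.toDual ℝ E3).symm.enorm_map _
  have hsupp : Function.support (gradient φ) ⊆ Ω := fun x hx =>
    hφ.subset <| support_fderiv_subset ℝ fun h => hx (by simp [gradient, h])
  rw [eLpNorm_congr_ae hu, eLpNorm_restrict_eq_of_support_subset hsupp,
    eLpNorm_congr_enorm_ae (ae_of_all _ henorm)]

theorem nontrivial_H01 (hΩo : IsOpen Ω) (hΩn : Ω.Nonempty) : Nontrivial (H01 Ω) := by
  obtain ⟨x, hx⟩ := hΩn
  obtain ⟨φ, hsupp, hcompact, hsmooth, -, hφx⟩ :=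
    exists_contDiff_tsupport_subset (n := ⊤) (hΩo.mem_nhds hx)
  have hval : MemLp φ 2 (volume.restrict Ω) :=
    (hsmooth.continuous.memLp_of_hasCompactSupport hcompact).restrict Ω
  have hgrad : MemLp (gradient φ) 2 (volume.restrict Ω) := by
    refine (Continuous.memLp_of_hasCompactSupport ?_ ?_).restrict Ω
    · exact (InnerProductSpace.toDual ℝ E3).symm.continuous.comp
        (hsmooth.continuous_fderiv (by simp))
    · exact (hcompact.fderiv (𝕜 := ℝ)).comp_left
        (g := (InnerProductSpace.toDual ℝ E3).symm) (map_zero _)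
  let u : H01 Ω := ⟨WithLp.toLp 2 (hval.toLp, hgrad.toLp), subset_closure
    ⟨φ, ⟨hsmooth, hcompact, hsupp⟩, hval.coeFn_toLp, hgrad.coeFn_toLp⟩⟩
  refine ⟨u, 0, fun hu => ?_⟩
  have hφ : φ =ᵐ[volume.restrict Ω] 0 := (MemLp.toLp_eq_toLp_iff hval .zero).1 <|
    (congrArg (valCLM Ω) hu).trans (map_zero _)
  have := Measure.eqOn_open_of_ae_eq hφ hΩo hsmooth.continuous.continuousOn continuousOn_const hx
  simp [hφx] at this

end SobolevSpace

section Embedding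

variable {Ω : Set E3} {γ : ℝ}

theorem exists_gammaNorm_le_mul_gradNorm (hΩ : Bornology.IsBounded Ω) (hγ₀ : 0 < γ)
    (hγ₆ : γ ≤ 6) : ∃ C : ℝ≥0, ∀ u : H01 Ω, gammaNorm γ u ≤ C * gradNorm u := by
  refine ⟨eLpNormLESNormFDerivOfLeConst ℝ volume Ω 2 γ.toNNReal,
    H01.induction_on_testFunction ?_ fun φ hφ u hval hgrad => ?_⟩
  · exact (lowerSemicontinuous_eLpNorm _).isClosed_epigraph.preimage
      ((valCLM Ω).continuous.prodMk
        (ENNReal.continuous_const_mul ENNReal.coe_ne_top |>.comp continuous_gradNorm))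
  · rw [gammaNorm_of_ae_eq_testFunction hφ hval, gradNorm, eLpNorm_grad_of_ae_eq_gradient hφ hgrad]
    refine eLpNorm_le_eLpNorm_fderiv_of_le volume hφ.contDiff_one hφ.support_subset (by norm_num)
      (by simp; norm_num) ?_ hΩ
    rw [finrank_euclideanSpace_fin, Real.coe_toNNReal _ hγ₀.le]
    exact le_trans (by norm_num) (inv_anti₀ hγ₀ hγ₆)

theorem gammaNorm_ne_top (hΩ : Bornology.IsBounded Ω) (hγ₀ : 0 < γ) (hγ₆ : γ ≤ 6) (u : H01 Ω) :
    gammaNorm γ u ≠ ⊤ :=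
  let ⟨_, hC⟩ := exists_gammaNorm_le_mul_gradNorm hΩ hγ₀ hγ₆
  ne_top_of_le_ne_top (ENNReal.mul_ne_top ENNReal.coe_ne_top (gradNorm_ne_top u)) (hC u)

theorem gammaNorm_ne_zero (hΩo : IsOpen Ω) (hγ₀ : 0 < γ) {u : H01 Ω} (hu : u ≠ 0) :
    gammaNorm γ u ≠ 0 := fun h =>
  hu <| eq_zero_of_val hΩo u <|
    (eLpNorm_eq_zero_iff (aestronglyMeasurable_val u) (ENNReal.ofReal_pos.2 hγ₀).ne').1 h

theorem enorm_valCLM (u : H01 Ω) : ‖valCLM Ω u‖ₑ = gammaNorm 2 u := by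
  rw [gammaNorm, ENNReal.ofReal_ofNat]
  exact Lp.enorm_def _

theorem norm_le_mul_norm_of_enorm_le {X Y : Type*} [SeminormedAddGroup X] [SeminormedAddGroup Y]
    {x : X} {y : Y} {C : ℝ≥0} (h : ‖x‖ₑ ≤ C * ‖y‖ₑ) : ‖x‖ ≤ C * ‖y‖ := by
  rw [enorm_eq_nnnorm, enorm_eq_nnnorm, ← ENNReal.coe_mul, ENNReal.coe_le_coe] at h
  exact h

theorem exists_antilipschitzWith_gradCLM (hΩ : Bornology.IsBounded Ω) :
    ∃ C : ℝ≥0, AntilipschitzWith C (gradCLM Ω) := by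
  obtain ⟨C, hC⟩ := exists_gammaNorm_le_mul_gradNorm hΩ (γ := 2) (by norm_num) (by norm_num)
  refine ⟨C + 1, (gradCLM Ω).antilipschitz_of_bound fun u => ?_⟩
  have hval : ‖valCLM Ω u‖ ≤ C * ‖gradCLM Ω u‖ :=
    norm_le_mul_norm_of_enorm_le (by rw [enorm_valCLM, enorm_gradCLM]; exact hC u)
  calc ‖u‖ ≤ ‖valCLM Ω u‖ + ‖gradCLM Ω u‖ := norm_le_norm_valCLM_add_norm_gradCLM u
    _ ≤ C * ‖gradCLM Ω u‖ + ‖gradCLM Ω u‖ := by gcongr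
    _ = (C + 1 : ℝ≥0) * ‖gradCLM Ω u‖ := by push_cast; ring

theorem gradNorm_ne_zero (hΩ : Bornology.IsBounded Ω) {u : H01 Ω} (hu : u ≠ 0) :
    gradNorm u ≠ 0 := by
  obtain ⟨C, hC⟩ := exists_antilipschitzWith_gradCLM hΩ
  rwa [← enorm_gradCLM, enorm_ne_zero, map_ne_zero_iff _ hC.injective]

theorem memLp_val (hΩ : Bornology.IsBounded Ω) (hγ₀ : 0 < γ) (hγ₆ : γ ≤ 6) (u : H01 Ω) :
    MemLp (val u) (ENNReal.ofReal γ) (volume.restrict Ω) :=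
  ⟨aestronglyMeasurable_val u, (gammaNorm_ne_top hΩ hγ₀ hγ₆ u).lt_top⟩

theorem val_add (u v : H01 Ω) : val (u + v) =ᵐ[volume.restrict Ω] val u + val v :=
  Lp.coeFn_add _ _

theorem val_smul (c : ℝ) (u : H01 Ω) : val (c • u) =ᵐ[volume.restrict Ω] c • val u :=
  Lp.coeFn_smul _ _

/-- The Sobolev embedding of `H_0^1(Ω)` in `L^γ(Ω)`, for `1 ≤ γ ≤ 6`. -/
def embedding [Fact (1 ≤ ENNReal.ofReal γ)] (hΩ : Bornology.IsBounded Ω) (hγ₀ : 0 < γ)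
    (hγ₆ : γ ≤ 6) : H01 Ω →L[ℝ] Lp ℝ (ENNReal.ofReal γ) (volume.restrict Ω) :=
  LinearMap.mkContinuousOfExistsBound
    { toFun := fun u => (memLp_val hΩ hγ₀ hγ₆ u).toLp
      map_add' := fun u v =>
        (MemLp.toLp_congr _ ((memLp_val hΩ hγ₀ hγ₆ u).add (memLp_val hΩ hγ₀ hγ₆ v)) (val_add u v))
      map_smul' := fun c u =>
        (MemLp.toLp_congr _ ((memLp_val hΩ hγ₀ hγ₆ u).const_smul c) (val_smul c u)) } <| by
    obtain ⟨C, hC⟩ := exists_gammaNorm_le_mul_gradNorm hΩ hγ₀ hγ₆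
    refine ⟨C, fun u => ?_⟩
    have hemb : ‖(memLp_val hΩ hγ₀ hγ₆ u).toLp‖ ≤ C * ‖gradCLM Ω u‖ :=
      norm_le_mul_norm_of_enorm_le (by rw [Lp.enorm_toLp, enorm_gradCLM]; exact hC u)
    exact hemb.trans (by gcongr; exact norm_gradCLM_le u)

theorem enorm_embedding [Fact (1 ≤ ENNReal.ofReal γ)] (hΩ : Bornology.IsBounded Ω) (hγ₀ : 0 < γ)
    (hγ₆ : γ ≤ 6) (u : H01 Ω) : ‖embedding hΩ hγ₀ hγ₆ u‖ₑ = gammaNorm γ u :=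
  Lp.enorm_toLp (memLp_val hΩ hγ₀ hγ₆ u)

theorem continuous_gammaNorm (hΩ : Bornology.IsBounded Ω) (hγ₁ : 1 ≤ γ) (hγ₆ : γ ≤ 6) :
    Continuous fun u : H01 Ω => gammaNorm γ u := by
  have : Fact (1 ≤ ENNReal.ofReal γ) := ⟨ENNReal.one_le_ofReal.2 hγ₁⟩
  simpa only [enorm_embedding] using
    (embedding hΩ (zero_lt_one.trans_le hγ₁) hγ₆).continuous.enorm

variable (Ω) in
/-- The functional `u ↦ ∫ u` over the part of the ball `B(x, r)` in `Ω`, on `H_0^1(Ω)`. -/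
def ballIntegral (x : E3) (r : ℝ) : StrongDual ℝ (H01 Ω) :=
  (innerSL ℝ (indicatorConstLp 2 measurableSet_ball
    (measure_ball_lt_top (μ := volume.restrict Ω) (x := x) (r := r)).ne (1 : ℝ))).comp (valCLM Ω)

theorem ballIntegral_of_ae_eq_testFunction {φ : E3 → ℝ} (hφ : IsTestFunction Ω φ) {u : H01 Ω}
    (hu : val u =ᵐ[volume.restrict Ω] φ) (x : E3) (r : ℝ) :
    ballIntegral Ω x r u = ∫ y in ball x r, φ y := by
  have hL2 : ballIntegral Ω x r u = ∫ y in ball x r, val u y ∂(volume.restrict Ω) :=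
    L2.inner_indicatorConstLp_one _ _ _
  rw [hL2, integral_congr_ae (ae_restrict_of_ae hu), Measure.restrict_comm measurableSet_ball]
  refine setIntegral_eq_integral_of_forall_compl_eq_zero fun y hy => ?_
  exact Function.notMem_support.1 fun h => hy (hφ.support_subset h)

theorem exists_finset_gammaNorm_one_le (hΩ : Bornology.IsBounded Ω) {ε : ℝ≥0} (hε : 0 < ε) :
    ∃ (t : Finset E3) (r : ℝ) (C : ℝ≥0), ∀ u : H01 Ω,
      gammaNorm 1 u ≤ ε * gradNorm u + C * ∑ x ∈ t, ‖ballIntegral Ω x r u‖ₑ := by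
  obtain ⟨m, hm⟩ : ∃ m : ℝ≥0, m = volume Ω ^ (1 / 2 : ℝ) :=
    ⟨_, ENNReal.coe_toNNReal
      (ENNReal.rpow_ne_top_of_nonneg (by norm_num) hΩ.measure_lt_top.ne)⟩
  obtain ⟨t, r, C, hFr⟩ := exists_finset_lintegral_enorm_le (E := E3) (F := ℝ) (μ := volume) hΩ
    (ε := ε / (m + 1)) (by positivity)
  refine ⟨t, r, C, H01.induction_on_testFunction ?_ fun φ hφ u hval hgrad => ?_⟩
  · refine isClosed_le (continuous_gammaNorm hΩ le_rfl (by norm_num)) (.add ?_ ?_)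
    · exact (ENNReal.continuous_const_mul ENNReal.coe_ne_top).comp continuous_gradNorm
    · exact (ENNReal.continuous_const_mul ENNReal.coe_ne_top).comp
        (continuous_finsetSum _ fun x _ => (ballIntegral Ω x r).continuous.enorm)
  have hgrad1 : ∫⁻ x, ‖fderiv ℝ φ x‖ₑ ≤ gradNorm u * m := by
    rw [← eLpNorm_one_eq_lintegral_enorm, ← eLpNorm_grad_of_ae_eq_gradient hφ hgrad, hm]
    refine (eLpNorm_le_eLpNorm_mul_rpow_measure_univ one_le_two
      (Lp.aestronglyMeasurable _)).trans_eq ?_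
    norm_num [gradNorm, grad]
  have hεm : ε / (m + 1) * m ≤ ε := by
    rw [div_mul_eq_mul_div]
    exact div_le_of_le_mul₀ zero_le zero_le (by gcongr; exact le_self_add)
  simp_rw [ballIntegral_of_ae_eq_testFunction hφ hval]
  rw [gammaNorm_of_ae_eq_testFunction hφ hval, ENNReal.ofReal_one, eLpNorm_one_eq_lintegral_enorm]
  calc ∫⁻ x, ‖φ x‖ₑ
      ≤ ↑(ε / (m + 1)) * (∫⁻ x, ‖fderiv ℝ φ x‖ₑ) + C * ∑ x ∈ t, ‖∫ y in ball x r, φ y‖ₑ :=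
        hFr φ hφ.contDiff_one hφ.support_subset
    _ ≤ ↑(ε / (m + 1)) * (gradNorm u * m) + C * ∑ x ∈ t, ‖∫ y in ball x r, φ y‖ₑ := by gcongr
    _ = ↑(ε / (m + 1) * m) * gradNorm u + C * ∑ x ∈ t, ‖∫ y in ball x r, φ y‖ₑ := by
        push_cast; ring
    _ ≤ ε * gradNorm u + C * ∑ x ∈ t, ‖∫ y in ball x r, φ y‖ₑ := by gcongr

/-- The exponent `θ = (6 - γ) / (5 γ)` solves `1 / γ = θ / 1 + (1 - θ) / 6`. -/
theorem exists_gammaNorm_le_mul_rpow (hΩ : Bornology.IsBounded Ω) (hγ₁ : 1 ≤ γ) (hγ₆ : γ ≤ 6) :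
    ∃ C : ℝ≥0, ∀ u : H01 Ω,
      gammaNorm γ u ≤
        C * gammaNorm 1 u ^ ((6 - γ) / (5 * γ)) * gradNorm u ^ (1 - (6 - γ) / (5 * γ)) := by
  obtain ⟨C, hC⟩ := exists_gammaNorm_le_mul_gradNorm hΩ (γ := 6) (by norm_num) le_rfl
  set θ := (6 - γ) / (5 * γ) with hθ
  have hθ₀ : 0 ≤ θ := div_nonneg (by linarith) (by linarith)
  have hθ₁ : θ ≤ 1 := (div_le_one (by linarith)).2 (by linarith)
  refine ⟨C ^ (1 - θ), fun u => ?_⟩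
  calc gammaNorm γ u ≤ gammaNorm 1 u ^ θ * gammaNorm 6 u ^ (1 - θ) :=
        eLpNorm_le_eLpNorm_rpow_mul_eLpNorm_rpow (aestronglyMeasurable_val u) one_pos
          (by linarith) (by norm_num) hθ₀ hθ₁ (by rw [hθ]; field_simp; ring)
    _ ≤ gammaNorm 1 u ^ θ * (C * gradNorm u) ^ (1 - θ) := by
        gcongr
        exact hC u
    _ = (C ^ (1 - θ) : ℝ≥0) * gammaNorm 1 u ^ θ * gradNorm u ^ (1 - θ) := by
        rw [ENNReal.mul_rpow_of_nonneg _ _ (sub_nonneg.2 hθ₁),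
          ENNReal.coe_rpow_of_nonneg _ (sub_nonneg.2 hθ₁)]
        ring

theorem gradNorm_le_one {u : H01 Ω} (hu : ‖u‖ ≤ 1) : gradNorm u ≤ 1 := by
  rw [← enorm_gradCLM, enorm_eq_nnnorm]
  exact mod_cast (norm_gradCLM_le u).trans hu

theorem exists_finset_dual_gammaNorm_one_le (hΩ : Bornology.IsBounded Ω) {ε : ℝ≥0} (hε : 0 < ε) :
    ∃ δ : ℝ≥0, 0 < δ ∧ ∃ t : Finset (StrongDual ℝ (H01 Ω)), ∀ u : H01 Ω, ‖u‖ ≤ 1 →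
      (∀ ℓ ∈ t, ‖ℓ u‖ ≤ δ) → gammaNorm 1 u ≤ ε := by
  classical
  obtain ⟨t, r, C, htC⟩ := exists_finset_gammaNorm_one_le hΩ (half_pos hε)
  refine ⟨ε / 2 / (C * t.card + 1), by positivity, t.image fun x => ballIntegral Ω x r,
    fun u hu hsmall => (htC u).trans ?_⟩
  set δ := ε / 2 / (C * t.card + 1)
  have hδ : C * (t.card * δ) ≤ ε / 2 := by
    rw [← mul_assoc, mul_div_assoc']
    exact div_le_of_le_mul₀ zero_le zero_le (by rw [mul_comm]; gcongr; exact le_self_add)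
  have hball : ∀ x ∈ t, ‖ballIntegral Ω x r u‖ₑ ≤ δ := fun x hx => by
    rw [enorm_eq_nnnorm]
    exact mod_cast hsmall _ (Finset.mem_image_of_mem _ hx)
  calc (ε / 2 : ℝ≥0) * gradNorm u + C * ∑ x ∈ t, ‖ballIntegral Ω x r u‖ₑ
      ≤ (ε / 2 : ℝ≥0) * 1 + C * (t.card * δ) := by
        gcongr
        · exact gradNorm_le_one hu
        · exact (Finset.sum_le_card_nsmul _ _ _ hball).trans_eq (nsmul_eq_mul _ _)
    _ ≤ (ε / 2 : ℝ≥0) + (ε / 2 : ℝ≥0) := by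
        rw [mul_one]
        gcongr
        exact mod_cast hδ
    _ = ε := by rw [← ENNReal.coe_add, add_halves]

theorem exists_finset_dual_gammaNorm_le (hΩ : Bornology.IsBounded Ω) (hγ₁ : 1 ≤ γ) (hγ₆ : γ < 6)
    {ε : ℝ≥0} (hε : 0 < ε) :
    ∃ δ : ℝ≥0, 0 < δ ∧ ∃ t : Finset (StrongDual ℝ (H01 Ω)), ∀ u : H01 Ω, ‖u‖ ≤ 1 →
      (∀ ℓ ∈ t, ‖ℓ u‖ ≤ δ) → gammaNorm γ u ≤ ε := by
  obtain ⟨C, hC⟩ := exists_gammaNorm_le_mul_rpow hΩ hγ₁ hγ₆.le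
  set θ := (6 - γ) / (5 * γ)
  have hθ₀ : 0 < θ := div_pos (by linarith) (by linarith)
  have hθ₁ : θ ≤ 1 := (div_le_one (by linarith)).2 (by linarith)
  obtain ⟨δ, hδ, t, ht⟩ := exists_finset_dual_gammaNorm_one_le hΩ
    (ε := (ε / (C + 1)) ^ θ⁻¹) (by positivity)
  refine ⟨δ, hδ, t, fun u hu hsmall => ?_⟩
  calc gammaNorm γ u ≤ C * gammaNorm 1 u ^ θ * gradNorm u ^ (1 - θ) := hC u
    _ ≤ C * (((ε / (C + 1)) ^ θ⁻¹ : ℝ≥0) : ℝ≥0∞) ^ θ * 1 := by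
        gcongr
        exacts [ht u hu hsmall, ENNReal.rpow_le_one (gradNorm_le_one hu) (sub_nonneg.2 hθ₁)]
    _ = (C * (ε / (C + 1)) : ℝ≥0) := by
        rw [mul_one, ← ENNReal.coe_rpow_of_nonneg _ hθ₀.le, ← NNReal.rpow_mul,
          inv_mul_cancel₀ hθ₀.ne', NNReal.rpow_one, ENNReal.coe_mul]
    _ ≤ ε := by
        rw [ENNReal.coe_le_coe, mul_div_assoc']
        exact div_le_of_le_mul₀ zero_le zero_le (by rw [mul_comm]; gcongr; exact le_self_add)

theorem isCompactOperator_embedding [Fact (1 ≤ ENNReal.ofReal γ)] (hΩ : Bornology.IsBounded Ω)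
    (hγ₀ : 0 < γ) (hγ₆ : γ < 6) : IsCompactOperator (embedding hΩ hγ₀ hγ₆.le) := by
  refine isCompactOperator_of_forall_exists_finset_dual fun ε hε => ?_
  obtain ⟨δ, hδ, t, ht⟩ := exists_finset_dual_gammaNorm_le hΩ (ENNReal.one_le_ofReal.1 Fact.out)
    hγ₆ (Real.toNNReal_pos.2 hε)
  refine ⟨δ, hδ, t, fun u hu hsmall => ?_⟩
  have h := ht u hu hsmall
  rw [← enorm_embedding hΩ hγ₀ hγ₆.le, enorm_eq_nnnorm, ENNReal.coe_le_coe] at h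
  exact (NNReal.coe_le_coe.2 h).trans_eq (Real.coe_toNNReal ε hε.le)

end Embedding

section Extremal

variable {Ω : Set E3} {a γ : ℝ}

theorem constC_pos (ha : 0 < a) (hγ₂ : 2 < γ) (hγ₄ : γ < 4) : 0 < constC a γ := by
  have : 0 < γ - 2 := by linarith
  have : 0 < 4 - γ := by linarith
  unfold constC
  positivity

theorem constC0_pos (hγ₀ : 0 < γ) : 0 < constC0 γ := by
  unfold constC0
  positivity

theorem constC0_lt_one (hγ₂ : 2 < γ) (hγ₄ : γ < 4) : constC0 γ < 1 := by
  have hγ : 0 < γ - 2 := by linarith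
  have bernoulli : (2 : ℝ) ^ ((γ - 2) / 2) < γ / 2 := by
    have := rpow_one_add_lt_one_add_mul_self (s := 1) (p := (γ - 2) / 2) (by norm_num)
      one_ne_zero (by linarith) (by linarith)
    norm_num at this
    linarith
  have htwo : 2 < (γ / 2) ^ (2 / (γ - 2)) :=
    calc (2 : ℝ) = (2 ^ ((γ - 2) / 2)) ^ (2 / (γ - 2)) := by
          rw [← Real.rpow_mul zero_le_two, div_mul_div_cancel₀ two_ne_zero, div_self hγ.ne',
            Real.rpow_one]
      _ < (γ / 2) ^ (2 / (γ - 2)) := Real.rpow_lt_rpow (by positivity) bernoulli (by positivity)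
  rw [constC0, ← inv_div γ 2, Real.inv_rpow (by linarith), ← div_eq_mul_inv,
    div_lt_one (by positivity)]
  exact htwo

theorem lam_ne_zero (ha : 0 < a) (hγ₂ : 2 < γ) (hγ₄ : γ < 4) (hΩo : IsOpen Ω)
    (hΩ : Bornology.IsBounded Ω) {u : H01 Ω} (hu : u ≠ 0) : lam a γ u ≠ 0 := by
  have hγ₀ : 0 < γ := by linarith
  have hquot : 0 < gammaNorm γ u / gradNorm u :=
    ENNReal.div_pos (gammaNorm_ne_zero hΩo hγ₀ hu) (gradNorm_ne_top u)
  have hquot_top : gammaNorm γ u / gradNorm u ≠ ⊤ :=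
    ENNReal.div_ne_top (gammaNorm_ne_top hΩ hγ₀ (by linarith) u) (gradNorm_ne_zero hΩ hu)
  exact mul_ne_zero (ENNReal.ofReal_pos.2 (constC_pos ha hγ₂ hγ₄)).ne'
    (ENNReal.rpow_pos hquot hquot_top).ne'

theorem lam_ne_top (hγ₂ : 2 ≤ γ) (hγ₆ : γ ≤ 6) (hΩ : Bornology.IsBounded Ω) {u : H01 Ω}
    (hu : u ≠ 0) : lam a γ u ≠ ⊤ :=
  ENNReal.mul_ne_top ENNReal.ofReal_ne_top <|
    ENNReal.rpow_ne_top_of_nonneg (div_nonneg (by linarith) (by linarith)) <|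
      ENNReal.div_ne_top (gammaNorm_ne_top hΩ (by linarith) hγ₆ u) (gradNorm_ne_zero hΩ hu)

theorem lam0_lt_lam (ha : 0 < a) (hγ₂ : 2 < γ) (hγ₄ : γ < 4) (hΩo : IsOpen Ω)
    (hΩ : Bornology.IsBounded Ω) {u : H01 Ω} (hu : u ≠ 0) : lam0 a γ u < lam a γ u :=
  calc lam0 a γ u < 1 * lam a γ u :=
        ENNReal.mul_lt_mul_left (lam_ne_zero ha hγ₂ hγ₄ hΩo hΩ hu)
          (lam_ne_top hγ₂.le (by linarith) hΩ hu) (by simpa using constC0_lt_one hγ₂ hγ₄)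
    _ = lam a γ u := one_mul _

/-- `u` is an extremal function of the embedding of `H_0^1(Ω)` in `L^γ(Ω)`: it maximizes
`‖v‖_γ / ‖v‖` over the nonzero `v`. -/
structure IsExtremal (γ : ℝ) (u : H01 Ω) : Prop where
  ne_zero : u ≠ 0
  quotient_le : ∀ v : H01 Ω, v ≠ 0 → gammaNorm γ v / gradNorm v ≤ gammaNorm γ u / gradNorm u

theorem exists_isExtremal (hΩo : IsOpen Ω) (hΩ : Bornology.IsBounded Ω) (hΩn : Ω.Nonempty)
    (hγ₁ : 1 ≤ γ) (hγ₆ : γ < 6) : ∃ u : H01 Ω, IsExtremal γ u := by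
  have : Fact (1 ≤ ENNReal.ofReal γ) := ⟨ENNReal.one_le_ofReal.2 hγ₁⟩
  have : Nontrivial (H01 Ω) := nontrivial_H01 hΩo hΩn
  have hγ₀ : 0 < γ := zero_lt_one.trans_le hγ₁
  obtain ⟨C, hC⟩ := exists_antilipschitzWith_gradCLM hΩ
  obtain ⟨u, hu, hmax⟩ :=
    exists_maximizer_of_isCompactOperator (isCompactOperator_embedding hΩ hγ₀ hγ₆) hC
  refine ⟨u, hu, fun v hv => ?_⟩
  have hprod : gammaNorm γ v * gradNorm u ≤ gammaNorm γ u * gradNorm v := by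
    simp only [← enorm_embedding hΩ hγ₀ hγ₆.le, ← enorm_gradCLM, enorm_eq_nnnorm]
    exact mod_cast hmax v
  rw [ENNReal.div_le_iff (gradNorm_ne_zero hΩ hv) (gradNorm_ne_top v), ← ENNReal.mul_div_right_comm]
  exact (ENNReal.le_div_iff_mul_le (.inl (gradNorm_ne_zero hΩ hu)) (.inl (gradNorm_ne_top u))).2
    hprod

namespace IsExtremal

variable {u : H01 Ω}

theorem lam_le (h : IsExtremal γ u) (hγ₂ : 2 ≤ γ) {v : H01 Ω} (hv : v ≠ 0) :
    lam a γ v ≤ lam a γ u :=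
  mul_le_mul_right
    (ENNReal.rpow_le_rpow (h.quotient_le v hv) (div_nonneg (by linarith) (by linarith))) _

theorem lamStar_eq (h : IsExtremal γ u) (hγ₂ : 2 ≤ γ) : lamStar Ω a γ = lam a γ u :=
  le_antisymm (iSup_le fun v => h.lam_le hγ₂ v.2)
    (le_iSup (fun v : {v : H01 Ω // v ≠ 0} => lam a γ v.1) ⟨u, h.ne_zero⟩)

theorem lam0Star_eq (h : IsExtremal γ u) (hγ₂ : 2 ≤ γ) : lam0Star Ω a γ = lam0 a γ u :=
  le_antisymm (iSup_le fun v => mul_le_mul_right (h.lam_le hγ₂ v.2) _)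
    (le_iSup (fun v : {v : H01 Ω // v ≠ 0} => lam0 a γ v.1) ⟨u, h.ne_zero⟩)

theorem bestConst_eq (h : IsExtremal γ u) (hΩ : Bornology.IsBounded Ω) :
    bestConst Ω γ = gradNorm u / gammaNorm γ u := by
  have inv_quotient (v : H01 Ω) (hv : v ≠ 0) :
      (gammaNorm γ v / gradNorm v)⁻¹ = gradNorm v / gammaNorm γ v :=
    ENNReal.inv_div (.inl (gradNorm_ne_top v)) (.inl (gradNorm_ne_zero hΩ hv))
  refine le_antisymm (iInf_le (fun v : {v : H01 Ω // v ≠ 0} =>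
    gradNorm v.1 / gammaNorm γ v.1) ⟨u, h.ne_zero⟩) (le_iInf fun v => ?_)
  rw [← inv_quotient u h.ne_zero, ← inv_quotient v v.2]
  exact ENNReal.inv_le_inv.2 (h.quotient_le v v.2)

theorem bestConst_pos (h : IsExtremal γ u) (hΩ : Bornology.IsBounded Ω) (hγ₀ : 0 < γ)
    (hγ₆ : γ ≤ 6) : 0 < bestConst Ω γ := by
  rw [h.bestConst_eq hΩ]
  exact ENNReal.div_pos (gradNorm_ne_zero hΩ h.ne_zero) (gammaNorm_ne_top hΩ hγ₀ hγ₆ u)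

theorem bestConst_lt_top (h : IsExtremal γ u) (hΩo : IsOpen Ω) (hΩ : Bornology.IsBounded Ω)
    (hγ₀ : 0 < γ) : bestConst Ω γ < ⊤ := by
  rw [h.bestConst_eq hΩ]
  exact ENNReal.div_lt_top (gradNorm_ne_top u) (gammaNorm_ne_zero hΩo hγ₀ h.ne_zero)

theorem lamStar_eq_mul_bestConst (h : IsExtremal γ u) (hΩ : Bornology.IsBounded Ω)
    (hγ₂ : 2 ≤ γ) :
    lamStar Ω a γ = ENNReal.ofReal (constC a γ) * bestConst Ω γ ^ (2 * γ / (2 - γ)) := by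
  rw [h.lamStar_eq hγ₂, lam, h.bestConst_eq hΩ,
    ← ENNReal.inv_div (.inl (gradNorm_ne_top u)) (.inl (gradNorm_ne_zero hΩ h.ne_zero)),
    ENNReal.inv_rpow, ← ENNReal.rpow_neg, ← div_neg, neg_sub]

end IsExtremal

end Extremal

section FiberProfile

/-- The function of `t` that the fiber map `ψ_{l,u}` becomes on `t > 0` once `A` stands for `‖u‖²`
and `G` for `‖u‖_γ^γ`. -/
def fiberProfile (a γ l A G t : ℝ) : ℝ :=
  a / 2 * A * t ^ 2 + l / 4 * A ^ 2 * t ^ 4 - 1 / γ * G * t ^ γ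

variable {a γ l A G t : ℝ}

theorem fiberProfile_eq_sq_mul (ht : 0 < t) :
    fiberProfile a γ l A G t =
      t ^ 2 * (a / 2 * A + 1 / 4 * A * (l * A * t ^ 2) - 1 / γ * G * t ^ (γ - 2)) := by
  have hpow : t ^ γ = t ^ 2 * t ^ (γ - 2) := by
    rw [← Real.rpow_natCast t 2, ← Real.rpow_add ht]
    norm_num
  rw [fiberProfile, hpow]
  ring

theorem deriv_fiberProfile (hγ : γ ≠ 0) (ht : 0 < t) :
    deriv (fiberProfile a γ l A G) t =
      a * A * t + l * A ^ 2 * t ^ 3 - G * t ^ (γ - 1) := by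
  refine (((((hasDerivAt_pow 2 t).const_mul _).add ((hasDerivAt_pow 4 t).const_mul _)).sub
    ((Real.hasDerivAt_rpow_const (.inl ht.ne')).const_mul _)).deriv).trans ?_
  field_simp
  norm_num
  ring

theorem deriv_fiberProfile_eq_mul (hγ : γ ≠ 0) (ht : 0 < t) :
    deriv (fiberProfile a γ l A G) t =
      t * (a * A + A * (l * A * t ^ 2) - G * t ^ (γ - 2)) := by
  have hpow : t ^ (γ - 1) = t * t ^ (γ - 2) := by
    rw [mul_comm, ← Real.rpow_add_one ht.ne']
    ring_nf
  rw [deriv_fiberProfile hγ ht, hpow]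
  ring

theorem deriv_deriv_fiberProfile (hγ : γ ≠ 0) (ht : 0 < t) :
    deriv (deriv (fiberProfile a γ l A G)) t =
      a * A + 3 * A * (l * A * t ^ 2) - (γ - 1) * G * t ^ (γ - 2) := by
  have hderiv : Set.EqOn (deriv (fiberProfile a γ l A G))
      (fun s => a * A * s + l * A ^ 2 * s ^ 3 - G * s ^ (γ - 1)) (Set.Ioi 0) :=
    fun s hs => deriv_fiberProfile hγ hs
  rw [hderiv.deriv isOpen_Ioi ht]
  refine (((((hasDerivAt_id t).const_mul _).add ((hasDerivAt_pow 3 t).const_mul _)).sub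
    ((Real.hasDerivAt_rpow_const (.inl ht.ne')).const_mul _)).deriv).trans ?_
  rw [show γ - 1 - 1 = γ - 2 by ring]
  norm_num
  ring

theorem critical_linear_system_iff {y z : ℝ} (hγ : γ ≠ 4) (hA : A ≠ 0) (hG : G ≠ 0) :
    (a * A + A * z - G * y = 0 ∧ a * A + 3 * A * z - (γ - 1) * G * y = 0) ↔
      (y = 2 * a / (4 - γ) * (A / G) ∧ z = a * ((γ - 2) / (4 - γ))) := by
  have hγ' : 4 - γ ≠ 0 := sub_ne_zero.2 hγ.symm
  constructor
  · rintro ⟨h₁, h₂⟩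
    constructor <;> field_simp
    · linear_combination h₂ - 3 * h₁
    · exact mul_left_cancel₀ hA (by linear_combination h₂ - (γ - 1) * h₁)
  · rintro ⟨rfl, rfl⟩
    constructor <;> field_simp <;> ring

theorem zero_linear_system_iff {y z : ℝ} (hγ₀ : γ ≠ 0) (hγ : γ ≠ 4) (hA : A ≠ 0) (hG : G ≠ 0) :
    (a / 2 * A + 1 / 4 * A * z - 1 / γ * G * y = 0 ∧ a * A + A * z - G * y = 0) ↔
      (y = a * γ / (4 - γ) * (A / G) ∧ z = 2 * (a * ((γ - 2) / (4 - γ)))) := by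
  have hγ' : 4 - γ ≠ 0 := sub_ne_zero.2 hγ.symm
  constructor
  · rintro ⟨h₁, h₂⟩
    field_simp at h₁
    constructor <;> field_simp
    · linear_combination γ * h₂ - 1 / 2 * h₁
    · exact mul_left_cancel₀ hA (by linear_combination 4 * h₂ - 1 / 2 * h₁)
  · rintro ⟨rfl, rfl⟩
    constructor <;> field_simp <;> ring

theorem sq_mul_rpow_sq_mul_rpow_eq_one {N P κ : ℝ} (hN : 0 < N) (hP : 0 < P) (hκ : 0 < κ)
    (hγ : γ ≠ 2) :
    N ^ 2 * ((κ * (N ^ 2 / P ^ γ)) ^ (1 / (γ - 2))) ^ 2 *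
      (κ⁻¹ ^ (2 / (γ - 2)) * (P / N) ^ (2 * γ / (γ - 2))) = 1 := by
  have hγ' : γ - 2 ≠ 0 := sub_ne_zero.2 hγ
  refine Real.eq_one_of_pos_of_log_eq_zero (by positivity) ?_
  rw [Real.log_mul (by positivity) (by positivity), Real.log_mul (by positivity) (by positivity),
    Real.log_mul (by positivity) (by positivity), Real.log_pow, Real.log_pow,
    Real.log_rpow (by positivity), Real.log_rpow (by positivity), Real.log_rpow (by positivity),
    Real.log_mul (by positivity) (by positivity), Real.log_div (by positivity) (by positivity),
    Real.log_div hP.ne' hN.ne', Real.log_pow, Real.log_rpow hP, Real.log_inv]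
  field_simp
  push_cast
  ring

theorem rpow_eq_and_mul_sq_eq_iff {N P κ c : ℝ} (hN : 0 < N) (hP : 0 < P) (hκ : 0 < κ)
    (hc : 0 < c) (hγ : γ ≠ 2) :
    (0 < t ∧ 0 < l ∧ t ^ (γ - 2) = κ * (N ^ 2 / P ^ γ) ∧ l * N ^ 2 * t ^ 2 = c) ↔
      (t = (κ * (N ^ 2 / P ^ γ)) ^ (1 / (γ - 2)) ∧
        l = c * (κ⁻¹ ^ (2 / (γ - 2)) * (P / N) ^ (2 * γ / (γ - 2)))) := by
  have hγ' : γ - 2 ≠ 0 := sub_ne_zero.2 hγ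
  have hone := sq_mul_rpow_sq_mul_rpow_eq_one hN hP hκ hγ
  have hx : 0 < κ * (N ^ 2 / P ^ γ) := by positivity
  rw [one_div] at hone ⊢
  constructor
  · rintro ⟨ht, -, hpow, rfl⟩
    obtain rfl := (Real.eq_rpow_inv ht.le hx.le hγ').2 hpow
    exact ⟨rfl, by linear_combination -l * hone⟩
  · rintro ⟨rfl, rfl⟩
    exact ⟨by positivity, by positivity, (Real.eq_rpow_inv (by positivity) hx.le hγ').1 rfl,
      by linear_combination c * hone⟩

end FiberProfile

section FiberMap

variable {Ω : Set E3} {a γ l t : ℝ} {u : H01 Ω}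

theorem integral_norm_grad_sq (u : H01 Ω) :
    ∫ x in Ω, ‖grad u x‖ ^ 2 = (gradNorm u).toReal ^ 2 := by
  have hgrad : MemLp (grad u) 2 (volume.restrict Ω) := Lp.memLp _
  rw [gradNorm, hgrad.eLpNorm_eq_integral_rpow_norm two_ne_zero ENNReal.ofNat_ne_top,
    ENNReal.toReal_ofReal (by positivity), ENNReal.toReal_ofNat, ← Real.rpow_natCast,
    ← Real.rpow_mul (by positivity)]
  norm_num

theorem integral_abs_val_rpow (hΩ : Bornology.IsBounded Ω) (hγ₀ : 0 < γ) (hγ₆ : γ ≤ 6)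
    (u : H01 Ω) : ∫ x in Ω, |val u x| ^ γ = (gammaNorm γ u).toReal ^ γ := by
  rw [gammaNorm, (memLp_val hΩ hγ₀ hγ₆ u).eLpNorm_eq_integral_rpow_norm
      (ENNReal.ofReal_pos.2 hγ₀).ne' ENNReal.ofReal_ne_top,
    ENNReal.toReal_ofReal (by positivity), ENNReal.toReal_ofReal hγ₀.le,
    ← Real.rpow_mul (by positivity), inv_mul_cancel₀ hγ₀.ne', Real.rpow_one]
  rfl

theorem grad_smul (c : ℝ) (u : H01 Ω) : grad (c • u) =ᵐ[volume.restrict Ω] c • grad u :=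
  Lp.coeFn_smul _ _

theorem fiber_eqOn_fiberProfile (a l : ℝ) (hΩ : Bornology.IsBounded Ω) (hγ₀ : 0 < γ) (hγ₆ : γ ≤ 6)
    (u : H01 Ω) :
    Set.EqOn (fiber a γ l u)
      (fiberProfile a γ l ((gradNorm u).toReal ^ 2) ((gammaNorm γ u).toReal ^ γ)) (Set.Ioi 0) := by
  intro t ht
  have hgrad : ∫ x in Ω, ‖grad (t • u) x‖ ^ 2 = t ^ 2 * ∫ x in Ω, ‖grad u x‖ ^ 2 := by
    rw [← integral_const_mul]
    refine integral_congr_ae ?_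
    filter_upwards [grad_smul t u] with x hx
    rw [hx, Pi.smul_apply, norm_smul, mul_pow, Real.norm_eq_abs, sq_abs]
  have hval : ∫ x in Ω, |val (t • u) x| ^ γ = t ^ γ * ∫ x in Ω, |val u x| ^ γ := by
    rw [← integral_const_mul]
    refine integral_congr_ae ?_
    filter_upwards [val_smul t u] with x hx
    rw [hx, Pi.smul_apply, smul_eq_mul, abs_mul, abs_of_pos ht,
      Real.mul_rpow (le_of_lt ht) (abs_nonneg _)]
  rw [fiber, energy, fiberProfile, hgrad, hval, integral_norm_grad_sq,
    integral_abs_val_rpow hΩ hγ₀ hγ₆]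
  ring

theorem toReal_gradNorm_pos (hΩ : Bornology.IsBounded Ω) (hu : u ≠ 0) :
    0 < (gradNorm u).toReal :=
  ENNReal.toReal_pos (gradNorm_ne_zero hΩ hu) (gradNorm_ne_top u)

theorem toReal_gammaNorm_pos (hΩo : IsOpen Ω) (hΩ : Bornology.IsBounded Ω) (hγ₀ : 0 < γ)
    (hγ₆ : γ ≤ 6) (hu : u ≠ 0) : 0 < (gammaNorm γ u).toReal :=
  ENNReal.toReal_pos (gammaNorm_ne_zero hΩo hγ₀ hu) (gammaNorm_ne_top hΩ hγ₀ hγ₆ u)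

theorem toReal_lam (hC : 0 ≤ constC a γ) (u : H01 Ω) :
    (lam a γ u).toReal = constC a γ *
      ((gammaNorm γ u).toReal / (gradNorm u).toReal) ^ (2 * γ / (γ - 2)) := by
  rw [lam, ENNReal.toReal_mul, ENNReal.toReal_ofReal hC, ← ENNReal.toReal_rpow, ENNReal.toReal_div]

theorem deriv_fiber_eq_zero_iff (hΩo : IsOpen Ω) (hΩ : Bornology.IsBounded Ω) (ha : 0 < a)
    (hγ₂ : 2 < γ) (hγ₄ : γ < 4) (hu : u ≠ 0) :
    (0 < t ∧ 0 < l ∧ deriv (fiber a γ l u) t = 0 ∧ deriv (deriv (fiber a γ l u)) t = 0) ↔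
      (t = tOf a γ u ∧ l = (lam a γ u).toReal) := by
  have hγ₀ : 0 < γ := by linarith
  have hγ₆ : γ ≤ 6 := by linarith
  have : 0 < 4 - γ := by linarith
  have : 0 < γ - 2 := by linarith
  have hN := toReal_gradNorm_pos hΩ hu
  have hP := toReal_gammaNorm_pos hΩo hΩ hγ₀ hγ₆ hu
  have hderiv := (fiber_eqOn_fiberProfile a l hΩ hγ₀ hγ₆ u).deriv isOpen_Ioi
  rw [tOf, integral_norm_grad_sq, integral_abs_val_rpow hΩ hγ₀ hγ₆,
    toReal_lam (constC_pos ha hγ₂ hγ₄).le, constC, ← inv_div (2 * a), mul_assoc,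
    ← rpow_eq_and_mul_sq_eq_iff hN hP (by positivity) (by positivity) hγ₂.ne']
  refine and_congr_right fun ht => and_congr_right fun _ => ?_
  rw [hderiv ht, hderiv.deriv isOpen_Ioi ht, deriv_fiberProfile_eq_mul hγ₀.ne' ht,
    deriv_deriv_fiberProfile hγ₀.ne' ht, mul_eq_zero_iff_left ht.ne']
  exact critical_linear_system_iff hγ₄.ne (by positivity) (by positivity)

theorem toReal_lam0 (ha : 0 < a) (hγ₂ : 2 < γ) (hγ₄ : γ < 4) (u : H01 Ω) :
    (lam0 a γ u).toReal = 2 * (a * ((γ - 2) / (4 - γ))) *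
      ((a * γ / (4 - γ))⁻¹ ^ (2 / (γ - 2)) *
        ((gammaNorm γ u).toReal / (gradNorm u).toReal) ^ (2 * γ / (γ - 2))) := by
  have hγ₀ : 0 < γ := by linarith
  have : 0 < 4 - γ := by linarith
  have hκ : (a * γ / (4 - γ))⁻¹ = 2 / γ * ((4 - γ) / (2 * a)) := by field_simp
  rw [lam0, ENNReal.toReal_mul, ENNReal.toReal_ofReal (constC0_pos hγ₀).le,
    toReal_lam (constC_pos ha hγ₂ hγ₄).le, hκ, Real.mul_rpow (by positivity) (by positivity),
    constC, constC0]
  ring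

theorem exists_fiber_eq_zero_iff (hΩo : IsOpen Ω) (hΩ : Bornology.IsBounded Ω) (ha : 0 < a)
    (hγ₂ : 2 < γ) (hγ₄ : γ < 4) (hu : u ≠ 0) :
    ∃ t₀ : ℝ, ∀ t l : ℝ,
      (0 < t ∧ 0 < l ∧ fiber a γ l u t = 0 ∧ deriv (fiber a γ l u) t = 0) ↔
        (t = t₀ ∧ l = (lam0 a γ u).toReal) := by
  have hγ₀ : 0 < γ := by linarith
  have hγ₆ : γ ≤ 6 := by linarith
  have : 0 < 4 - γ := by linarith
  have : 0 < γ - 2 := by linarith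
  have hN := toReal_gradNorm_pos hΩ hu
  have hP := toReal_gammaNorm_pos hΩo hΩ hγ₀ hγ₆ hu
  refine ⟨(a * γ / (4 - γ) * ((gradNorm u).toReal ^ 2 / (gammaNorm γ u).toReal ^ γ)) ^
    (1 / (γ - 2)), fun t l => ?_⟩
  rw [toReal_lam0 ha hγ₂ hγ₄,
    ← rpow_eq_and_mul_sq_eq_iff hN hP (by positivity) (by positivity) hγ₂.ne']
  refine and_congr_right fun ht => and_congr_right fun _ => ?_
  have hprofile := fiber_eqOn_fiberProfile a l hΩ hγ₀ hγ₆ u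
  rw [hprofile ht, hprofile.deriv isOpen_Ioi ht, deriv_fiberProfile_eq_mul hγ₀.ne' ht,
    fiberProfile_eq_sq_mul ht, mul_eq_zero_iff_left (by positivity), mul_eq_zero_iff_left ht.ne']
  exact zero_linear_system_iff hγ₀.ne' hγ₄.ne (by positivity) (by positivity)

end FiberMap

end Kirchhoff

end

theorem mainTheorem3 (Ω : Set Kirchhoff.E3) (hΩo : IsOpen Ω) (hΩb : Bornology.IsBounded Ω)
    (hΩn : Ω.Nonempty) (a γ : ℝ) (ha : 0 < a) (hγ2 : 2 < γ) (hγ4 : γ < 4) :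
    -- the pair `(t(u), λ(u))` is the only solution of `ψ' = ψ'' = 0`
    (∀ u : Kirchhoff.H01 Ω, u ≠ 0 → ∀ t l : ℝ,
      (0 < t ∧ 0 < l ∧ deriv (Kirchhoff.fiber a γ l u) t = 0 ∧
        deriv (deriv (Kirchhoff.fiber a γ l u)) t = 0) ↔
      (t = Kirchhoff.tOf a γ u ∧ l = (Kirchhoff.lam a γ u).toReal)) ∧
    -- `λ₀(u)` is the second entry of the only solution of `ψ = ψ' = 0`
    (∀ u : Kirchhoff.H01 Ω, u ≠ 0 → ∃ t₀ : ℝ, ∀ t l : ℝ,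
      (0 < t ∧ 0 < l ∧ Kirchhoff.fiber a γ l u t = 0 ∧
        deriv (Kirchhoff.fiber a γ l u) t = 0) ↔
      (t = t₀ ∧ l = (Kirchhoff.lam0 a γ u).toReal)) ∧
    -- `λ*` in terms of the best constant of the embedding
    (0 < Kirchhoff.bestConst Ω γ ∧ Kirchhoff.bestConst Ω γ < ⊤ ∧
      Kirchhoff.lamStar Ω a γ =
        ENNReal.ofReal (Kirchhoff.constC a γ) *
          Kirchhoff.bestConst Ω γ ^ (2 * γ / (2 - γ))) ∧
    Kirchhoff.lam0Star Ω a γ < Kirchhoff.lamStar Ω a γ ∧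
    Kirchhoff.lamStar Ω a γ < ⊤ ∧
    ∃ u : Kirchhoff.H01 Ω, u ≠ 0 ∧
      Kirchhoff.lam a γ u = Kirchhoff.lamStar Ω a γ ∧
      Kirchhoff.lam0 a γ u = Kirchhoff.lam0Star Ω a γ := by
  have hγ₀ : 0 < γ := by linarith
  have hγ₆ : γ ≤ 6 := by linarith
  obtain ⟨u, hu⟩ :=
    Kirchhoff.exists_isExtremal (γ := γ) hΩo hΩb hΩn (by linarith) (by linarith)
  have hstar := hu.lamStar_eq (a := a) hγ2.le
  have hstar₀ := hu.lam0Star_eq (a := a) hγ2.le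
  refine ⟨fun v hv t l => Kirchhoff.deriv_fiber_eq_zero_iff hΩo hΩb ha hγ2 hγ4 hv,
    fun v hv => Kirchhoff.exists_fiber_eq_zero_iff hΩo hΩb ha hγ2 hγ4 hv,
    ⟨hu.bestConst_pos hΩb hγ₀ hγ₆, hu.bestConst_lt_top hΩo hΩb hγ₀,
      hu.lamStar_eq_mul_bestConst hΩb hγ2.le⟩,
    ?_, ?_, u, hu.ne_zero, hstar.symm, hstar₀.symm⟩
  · rw [hstar₀, hstar]
    exact Kirchhoff.lam0_lt_lam ha hγ2 hγ4 hΩo hΩb hu.ne_zero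
  · rw [hstar]
    exact (Kirchhoff.lam_ne_top hγ2.le hγ₆ hΩb hu.ne_zero).lt_top
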